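/- Let $h$ be a Herglotz function, i.e. a holomorphic map of the open upper half-plane $\mathbb C_+$ into itself. For $r\in\mathbb R$ let $g_r(z)=(r-h(z))^{-1}$, $z\in\mathbb C_+$, which is again a Herglotz function, and let $\mu_r$ be the measure in its Herglotz representation, i.e. the unique positive Borel measure on $\mathbb R$ with $\int_{\mathbb R}\frac{d\mu_r(\lambda)}{1+\lambda^2}<\infty$ such that, for some real numbers $\alpha_r\ge 0$ and $\beta_r$, $$g_r(z)=\alpha_r z+\beta_r+\int_{\mathbb R}\left(\frac1{\lambda-z}-\frac{\lambda}{\lambda^2+1}\right)d\mu_r(\lambda)\qquad(z\in\mathbb C_+);$$ such a measure exists and is unique for every $r\in\mathbb R$. Let $\mu_r^{(s)}$ be the singular part of $\mu_r$ with respect to Lebesgue measure. Then $r\mapsto\mu_r^{(s)}$ is (almost everywhere) measurable on $[0,1]$, the averaged measure $\int_0^1\mu_r^{(s)}\,dr$, that is $B\mapsto\int_0^1\mu_r^{(s)}(B)\,dr$ on Borel sets $B\subseteq\mathbb R$, is absolutely continuous with respect to Lebesgue measure, and its density takes only the values $0$ and $1$ almost everywhere. -/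

import Mathlib

open MeasureTheory
open scoped ENNReal

noncomputable section

/-- A Herglotz function: a holomorphic map of the open upper half-plane into itself. The values
of `h` off the upper half-plane are irrelevant. -/
structure IsHerglotz (h : ℂ → ℂ) : Prop where
  differentiableOn : DifferentiableOn ℂ h {z : ℂ | 0 < z.im}
  mapsTo : Set.MapsTo h {z : ℂ | 0 < z.im} {z : ℂ | 0 < z.im}

/-- The triple `(α, β, μ)` represents `f` by the Herglotz formula
`f z = α z + β + ∫ (1 / (x - z) - x / (x ^ 2 + 1)) dμ(x)`, where `0 ≤ α` and
`∫ 1 / (1 + x ^ 2) dμ(x) < ∞`. -/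
structure IsHerglotzTriple (f : ℂ → ℂ) (α β : ℝ) (μ : Measure ℝ) : Prop where
  nonneg : 0 ≤ α
  lintegral_lt_top : ∫⁻ x : ℝ, ENNReal.ofReal (1 / (1 + x ^ 2)) ∂μ < ∞
  eq : ∀ z : ℂ, 0 < z.im →
    f z = α * z + β + ∫ x : ℝ, (1 / ((x : ℂ) - z) - (x : ℂ) / ((x : ℂ) ^ 2 + 1)) ∂μ

/-- `μ` is the measure that corresponds to `f` in the Herglotz representation. -/
def IsHerglotzMeasure (f : ℂ → ℂ) (μ : Measure ℝ) : Prop :=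
  ∃ α β : ℝ, IsHerglotzTriple f α β μ

/-- The function `g_r = (r - h)⁻¹`. -/
def herglotzShift (h : ℂ → ℂ) (r : ℝ) (z : ℂ) : ℂ := ((r : ℂ) - h z)⁻¹

/-- The averaged singular measure `∫₀¹ μ_r^{(s)} dr`, that is,
`B ↦ ∫₀¹ μ_r^{(s)}(B) dr`, where `μ_r^{(s)}` is the singular part of `μ_r` with respect to
Lebesgue measure. -/
def averagedSingularMeasure (μ : ℝ → Measure ℝ) : Measure ℝ :=
  (volume.restrict (Set.Icc (0 : ℝ) 1)).bind fun r => (μ r).singularPart volume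

end

/-! Write P(w, r) for the Poisson kernel of the upper half-plane at r seen from w. Since Im g_r(z) /
π = P(h(z), r), integrating over r in J turns the Poisson integral of the averaged measure `η = ∫_J
μ_r dr` into the harmonic measure of J seen from h(z), up to a linear term. Harmonic measure is at
most 1, so η is bounded by a multiple of Lebesgue measure (`IsHerglotz.exists_poissonIntegral_bind`,
`IsHerglotz.bind_le_smul_volume`).

For J = [0, 1], Fatou's theorem (`ae_tendsto_poissonIntegral`) identifies two densities almost
everywhere: that of η is ρ(x) = lim ω(h(x + iy), [0, 1]), where ω denotes harmonic measure, and that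
of the absolutely continuous part of μ_r is lim P(h(x + iy), r). With A(x) the integral of the
latter over r in [0, 1], the averaged singular measure is (ρ - A) dx.

It remains to see that ρ - A is 0 or 1. If h(x + iy) tends to a point of the open half-plane, limit
and integral commute and A = ρ. If it runs to the boundary, the kernels vanish in the limit for all
r but at most one, so A = 0, while ρ is 0 or 1 according to whether [0, 1] catches the whole
harmonic measure. No theorem on boundary values of h is needed: almost everywhere the harmonic
measures of rational half-lines and the kernels at rational points converge, by the same two uses of
Fatou's theorem, and this suffices for the alternative (`lintegral_liminf_halfPlaneKernel`). -/

/-! ### Schwarz formula and Herglotz representation on the disc -/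

open Metric Real in
/-- **Schwarz integral formula** on the unit disc. -/
theorem circleAverage_herglotzRieszKernel_mul_re {F : ℂ → ℂ} {w : ℂ}
    (hF : DiffContOnCl ℂ F (ball 0 1)) (hw : w ∈ ball (0 : ℂ) 1) :
    circleAverage (fun ζ => herglotzRieszKernel 0 w ζ * ((F ζ).re : ℂ)) 0 1
      = F w - (F 0).im * Complex.I := by
  have hFc : ContinuousOn F (sphere 0 1) :=
    hF.2.mono (sphere_subset_closedBall.trans_eq (closure_ball 0 one_ne_zero).symm)
  have hKc : ContinuousOn (herglotzRieszKernel 0 w) (sphere 0 1) := by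
    simpa using continuousOn_herglotzRieszKernel_sphere hw
  have hF' : DiffContOnCl ℂ F (ball 0 |1|) := by simpa using hF
  have hw' : w ∈ ball (0 : ℂ) |1| := by simpa using hw
  have h1 := hF'.circleAverage_smul_div hw'
  have h2 := hF'.circleAverage
  have h3 := hF.circleAverage_re_herglotzRieszKernel_smul hw
  have hne : ∀ z ∈ sphere (0 : ℂ) 1, z - w ≠ 0 := by
    intro z hz h0
    rw [sub_eq_zero] at h0
    subst h0
    simp at hz hw
    linarith
  have i1 : CircleIntegrable (fun ζ => herglotzRieszKernel 0 w ζ * F ζ) 0 1 :=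
    (hKc.mul hFc).circleIntegrable zero_le_one
  have i2 : CircleIntegrable (fun ζ => ((herglotzRieszKernel 0 w ζ).re : ℂ) * F ζ) 0 1 :=
    ContinuousOn.circleIntegrable zero_le_one
      ((Complex.continuous_ofReal.comp_continuousOn
        (Complex.continuous_re.comp_continuousOn hKc)).mul hFc)
  -- The kernel is 2ζ / (ζ - w) - 1: Cauchy's formula gives the first term and the mean value
  -- property the second.
  have h4 : circleAverage (fun ζ => herglotzRieszKernel 0 w ζ * F ζ) 0 1 = 2 * F w - F 0 := by
    have hd : ContinuousOn (fun z : ℂ => (z - 0) / (z - w)) (sphere 0 1) := by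
      apply ContinuousOn.div (by fun_prop) (by fun_prop) hne
    have e : circleAverage (fun ζ => herglotzRieszKernel 0 w ζ * F ζ) 0 1
        = circleAverage (fun ζ => (2 : ℂ) • (((ζ - 0) / (ζ - w)) • F ζ) - F ζ) 0 1 := by
      apply circleAverage_congr_sphere
      intro z hz
      have := hne z (by simpa using hz)
      simp only [herglotzRieszKernel_def, smul_eq_mul, sub_zero]
      field_simp
      ring
    rw [e, circleAverage_fun_sub, circleAverage_fun_smul, h1, h2, smul_eq_mul]
    · exact ((hd.smul hFc).const_smul (2 : ℂ)).circleIntegrable zero_le_one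
    · exact hFc.circleIntegrable zero_le_one
  have h5 : circleAverage (fun ζ => ((herglotzRieszKernel 0 w ζ).re : ℂ) * F ζ) 0 1 = F w := by
    rw [← h3]
    congr 1
  -- The integrand is the conjugate of (2 Re K - K) F, whose average is 2 F(w) - (2 F(w) - F(0)) by
  -- `h5` and `h4`.
  have h6 : circleAverage (fun ζ => herglotzRieszKernel 0 w ζ * (starRingEnd ℂ) (F ζ)) 0 1
      = (starRingEnd ℂ) (F 0) := by
    have e : (fun ζ => herglotzRieszKernel 0 w ζ * (starRingEnd ℂ) (F ζ))
        = Complex.conjCLE.toContinuousLinearMap ∘ (fun ζ => (2 : ℂ) •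
          (((herglotzRieszKernel 0 w ζ).re : ℂ) * F ζ) - herglotzRieszKernel 0 w ζ * F ζ) := by
      ext ζ
      have : (starRingEnd ℂ) (herglotzRieszKernel 0 w ζ)
          = 2 * ((herglotzRieszKernel 0 w ζ).re : ℂ) - herglotzRieszKernel 0 w ζ := by
        apply Complex.ext <;> simp
        ring
      have h' : (2 : ℂ) • (((herglotzRieszKernel 0 w ζ).re : ℂ) * F ζ)
          - herglotzRieszKernel 0 w ζ * F ζ
          = (starRingEnd ℂ) (herglotzRieszKernel 0 w ζ) * F ζ := by
        rw [this, smul_eq_mul]; ring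
      simp only [Function.comp_apply, h']
      simp
    have i3 : CircleIntegrable (fun ζ => (2 : ℂ) • (((herglotzRieszKernel 0 w ζ).re : ℂ) * F ζ))
        0 1 := i2.const_smul
    have i5 : CircleIntegrable (fun ζ => (2 : ℂ) • (((herglotzRieszKernel 0 w ζ).re : ℂ) * F ζ)
        - herglotzRieszKernel 0 w ζ * F ζ) 0 1 := i3.sub i1
    rw [e, ContinuousLinearMap.circleAverage_comp_comm _ i5,
      circleAverage_fun_sub i3 i1, circleAverage_fun_smul, h4, h5]
    simp
  have i4 : CircleIntegrable (fun ζ => herglotzRieszKernel 0 w ζ * (starRingEnd ℂ) (F ζ)) 0 1 :=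
    (hKc.mul (Complex.continuous_conj.comp_continuousOn hFc)).circleIntegrable zero_le_one
  have e : (fun ζ => herglotzRieszKernel 0 w ζ * ((F ζ).re : ℂ)) = fun ζ => (1 / 2 : ℂ) •
      (herglotzRieszKernel 0 w ζ * F ζ + herglotzRieszKernel 0 w ζ * (starRingEnd ℂ) (F ζ)) := by
    ext ζ
    rw [← mul_add, Complex.add_conj, smul_eq_mul]
    push_cast
    ring
  rw [e, circleAverage_fun_smul, circleAverage_fun_add i1 i4, h4, h6, smul_eq_mul]
  apply Complex.ext
  · simp
  · simp
    ring

open Metric Real Filter Topology in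
/-- **Herglotz representation** on the unit disc. -/
theorem exists_measure_sphere_integral_herglotzRieszKernel {F : ℂ → ℂ}
    (hF : DifferentiableOn ℂ F (ball 0 1)) (hpos : ∀ w ∈ ball (0 : ℂ) 1, 0 ≤ (F w).re) :
    ∃ ν : Measure (sphere (0 : ℂ) 1), IsFiniteMeasure ν ∧ ∀ w ∈ ball (0 : ℂ) 1,
      F w = (F 0).im * Complex.I + ∫ ζ : sphere (0 : ℂ) 1, herglotzRieszKernel 0 w ζ ∂ν := by
  let e : ℝ → sphere (0 : ℂ) 1 := fun θ => ⟨circleMap 0 1 θ, by simp⟩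
  have he : Continuous e := by
    apply Continuous.subtype_mk
    exact continuous_circleMap 0 1
  let ρ : ℕ → ℝ := fun n => 1 - 1 / ((n : ℝ) + 2)
  have hρ0 : ∀ n, 0 ≤ ρ n := fun n => by
    have : 1 / ((n : ℝ) + 2) ≤ 1 := by
      rw [div_le_one (by positivity)]; linarith [(n.cast_nonneg : (0 : ℝ) ≤ n)]
    simp only [ρ]; linarith
  have hρ1 : ∀ n, ρ n < 1 := fun n => by
    have : 0 < 1 / ((n : ℝ) + 2) := by positivity
    simp only [ρ]; linarith
  have hρ : Tendsto ρ atTop (𝓝 1) := by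
    have : Tendsto (fun n : ℕ => 1 / ((n : ℝ) + 2)) atTop (𝓝 0) := by
      simp_rw [one_div]
      exact tendsto_inv_atTop_zero.comp
        (tendsto_atTop_add_const_right _ _ tendsto_natCast_atTop_atTop)
    simpa [ρ] using (tendsto_const_nhds (x := (1 : ℝ))).sub this
  -- Dilations are regular up to the circle, so the Schwarz formula applies to them; the
  -- representing measure is a weak limit of their boundary densities.
  let G : ℕ → ℂ → ℂ := fun n w => F (ρ n * w)
  have hmem : ∀ n, ∀ w ∈ closedBall (0 : ℂ) 1, (ρ n : ℂ) * w ∈ ball (0 : ℂ) 1 := by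
    intro n w hw
    simp only [mem_closedBall, dist_zero_right, mem_ball, norm_mul, Complex.norm_real,
      norm_eq_abs, abs_of_nonneg (hρ0 n)] at hw ⊢
    calc ρ n * ‖w‖ ≤ ρ n * 1 := by gcongr; exact hρ0 n
      _ < 1 := by simpa using hρ1 n
  have hGd : ∀ n, DifferentiableOn ℂ (G n) (closedBall 0 1) := fun n =>
    hF.comp (by fun_prop) (hmem n)
  have hG : ∀ n, DiffContOnCl ℂ (G n) (ball 0 1) := fun n => by
    apply DifferentiableOn.diffContOnCl
    rw [closure_ball 0 one_ne_zero]
    exact hGd n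
  have hGpos : ∀ n θ, 0 ≤ (G n (circleMap 0 1 θ)).re := fun n θ =>
    hpos _ (hmem n _ (by simp))
  have hGc : ∀ n, Continuous fun θ => (G n (circleMap 0 1 θ)).re := fun n =>
    Complex.continuous_re.comp ((hGd n).continuousOn.comp_continuous (continuous_circleMap 0 1)
      (fun θ => by simp))
  let d : ℕ → ℝ → ℝ := fun n θ => (2 * π)⁻¹ * (G n (circleMap 0 1 θ)).re
  have hd0 : ∀ n θ, 0 ≤ d n θ := fun n θ => mul_nonneg (by positivity) (hGpos n θ)
  have hdc : ∀ n, Continuous (d n) := fun n => (hGc n).const_mul _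
  let m : ℕ → Measure ℝ := fun n =>
    (volume.restrict (Set.Ioc 0 (2 * π))).withDensity fun θ => ENNReal.ofReal (d n θ)
  have hint : ∀ n, IntegrableOn (d n) (Set.Ioc 0 (2 * π)) := fun n =>
    ((hdc n).integrableOn_Icc).mono_set Set.Ioc_subset_Icc_self
  -- By the mean value property all masses agree, so the measures stay in a compact set.
  have hm : ∀ n, (m n) Set.univ = ENNReal.ofReal (F 0).re := by
    intro n
    simp only [m]
    rw [withDensity_apply _ MeasurableSet.univ, Measure.restrict_univ,
      ← ofReal_integral_eq_lintegral_ofReal (hint n) (ae_of_all _ (hd0 n))]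
    congr 1
    have h2 : circleAverage (G n) 0 1 = G n 0 :=
      DiffContOnCl.circleAverage (by simpa using hG n)
    have h3 := congrArg Complex.re h2
    have ic : CircleIntegrable (G n) 0 1 := ContinuousOn.circleIntegrable zero_le_one
      ((hGd n).continuousOn.mono sphere_subset_closedBall)
    rw [← Complex.reCLM_apply, ← ContinuousLinearMap.circleAverage_comp_comm _ ic,
      circleAverage_def] at h3
    rw [← intervalIntegral.integral_of_le (by positivity)]
    simp only [d]
    rw [intervalIntegral.integral_const_mul]
    simpa [G] using h3
  have hfin : ∀ n, IsFiniteMeasure (m n) := fun n => ⟨by rw [hm n]; exact ENNReal.ofReal_lt_top⟩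
  have hfin' : ∀ n, IsFiniteMeasure ((m n).map e) := fun n => inferInstance
  let νn : ℕ → FiniteMeasure (sphere (0 : ℂ) 1) := fun n => ⟨(m n).map e, hfin' n⟩
  have hK := isCompact_setOfPred_finiteMeasure_eq_of_compactSpace (sphere (0 : ℂ) 1)
    (F 0).re.toNNReal
  -- A limit along a free ultrafilter replaces the choice of a convergent subsequence.
  let U : Ultrafilter ℕ := hyperfilter ℕ
  have hU : (U : Filter ℕ) ≤ atTop := by
    rw [← Nat.cofinite_eq_atTop]; exact hyperfilter_le_cofinite
  obtain ⟨ν, -, hν⟩ := hK.ultrafilter_le_nhds (U.map νn) (by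
    rw [le_principal_iff]
    refine Filter.Eventually.of_forall (f := (U : Filter ℕ)) (fun n => ?_)
    show (νn n).mass = _
    rw [← ENNReal.coe_inj, FiniteMeasure.ennreal_mass]
    show ((m n).map e) Set.univ = _
    rw [Measure.map_apply he.measurable MeasurableSet.univ, Set.preimage_univ, hm n]
    rfl)
  have hν : Tendsto νn U (𝓝 ν) := hν
  rw [FiniteMeasure.tendsto_iff_forall_integral_rclike_tendsto ℂ] at hν
  refine ⟨ν, inferInstance, fun w hw => ?_⟩
  have hKc : Continuous fun ζ : sphere (0 : ℂ) 1 => herglotzRieszKernel 0 w ζ := by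
    have : ContinuousOn (herglotzRieszKernel 0 w) (sphere 0 1) := by
      simpa using continuousOn_herglotzRieszKernel_sphere hw
    exact continuousOn_iff_continuous_domRestrict.1 this
  have h1 := hν (BoundedContinuousFunction.mkOfCompact ⟨_, hKc⟩)
  simp only [BoundedContinuousFunction.mkOfCompact_apply, ContinuousMap.coe_mk] at h1
  have h2 : ∀ n, ∫ ζ : sphere (0 : ℂ) 1, herglotzRieszKernel 0 w ζ ∂(νn n : Measure _)
      = F (ρ n * w) - (F 0).im * Complex.I := by
    intro n
    have := circleAverage_herglotzRieszKernel_mul_re (hG n) hw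
    simp only [G, mul_zero] at this
    rw [← this]
    show ∫ ζ : sphere (0 : ℂ) 1, herglotzRieszKernel 0 w ζ ∂((m n).map e) = _
    rw [integral_map he.aemeasurable hKc.aestronglyMeasurable, circleAverage_def,
      intervalIntegral.integral_of_le (by positivity)]
    simp only [m]
    rw [integral_withDensity_eq_integral_toReal_smul (by fun_prop) (by simp), ← integral_smul]
    congr 1
    ext θ
    rw [ENNReal.toReal_ofReal (hd0 n θ)]
    simp only [d, e, G]
    rw [mul_smul]
    congr 1
    rw [Complex.real_smul, mul_comm]
  simp_rw [h2] at h1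
  have h3 : Tendsto (fun n => F (ρ n * w) - (F 0).im * Complex.I) U
      (𝓝 (F w - (F 0).im * Complex.I)) := by
    refine Tendsto.sub_const (Tendsto.mono_left ?_ hU) _
    have hc : ContinuousAt F w := (hF.differentiableAt (isOpen_ball.mem_nhds hw)).continuousAt
    refine hc.tendsto.comp ?_
    have : Tendsto (fun n => (ρ n : ℂ) * w) atTop (𝓝 ((1 : ℝ) * w)) :=
      ((Complex.continuous_ofReal.tendsto _).comp hρ).mul_const w
    simpa using this
  rw [← tendsto_nhds_unique h3 h1]
  ring

/-! ### Transfer to the half-plane by the Cayley transform -/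

open Metric in
/-- **Herglotz representation** on the upper half-plane. -/
theorem IsHerglotz.exists_isHerglotzTriple {f : ℂ → ℂ} (hf : IsHerglotz f) :
    ∃ (α β : ℝ) (μ : Measure ℝ), IsHerglotzTriple f α β μ := by
  let c : ℂ → ℂ := fun w => Complex.I * (1 + w) / (1 - w)
  have hne : ∀ w ∈ ball (0 : ℂ) 1, 1 - w ≠ 0 := by
    intro w hw h
    rw [sub_eq_zero] at h
    simp [← h] at hw
  have hc : ∀ w ∈ ball (0 : ℂ) 1, 0 < (c w).im := by
    intro w hw
    have h1 : 0 < Complex.normSq (1 - w) := Complex.normSq_pos.2 (hne w hw)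
    have h2 : Complex.normSq w < 1 := by
      rw [Complex.normSq_eq_norm_sq]
      have : ‖w‖ < 1 := by simpa using hw
      nlinarith [norm_nonneg w]
    have h3 : (c w).im = (1 - Complex.normSq w) / Complex.normSq (1 - w) := by
      simp only [c, Complex.div_im, Complex.mul_im, Complex.mul_re, Complex.I_re, Complex.I_im,
        Complex.add_re, Complex.add_im, Complex.sub_re, Complex.sub_im, Complex.one_re,
        Complex.one_im]
      rw [← sub_div]
      congr 1
      rw [Complex.normSq_apply]
      ring
    rw [h3]
    exact div_pos (by linarith) h1
  let F : ℂ → ℂ := fun w => -Complex.I * f (c w)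
  have hF : DifferentiableOn ℂ F (ball 0 1) := by
    refine DifferentiableOn.const_mul (hf.differentiableOn.comp ?_ hc) _
    exact DifferentiableOn.div (by fun_prop) (by fun_prop) hne
  have hFre : ∀ w ∈ ball (0 : ℂ) 1, 0 ≤ (F w).re := by
    intro w hw
    have : 0 < (f (c w)).im := hf.mapsTo (hc w hw)
    simpa [F] using this.le
  obtain ⟨ν, hν, hrep⟩ := exists_measure_sphere_integral_herglotzRieszKernel hF hFre
  -- The Cayley transform sends 1 to infinity: the atom there becomes the linear term, and the rest
  -- of the circle maps to the line by `t`.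
  let o : sphere (0 : ℂ) 1 := ⟨1, by simp⟩
  let t : sphere (0 : ℂ) 1 → ℝ := fun ζ => (Complex.I * (1 + ζ) / (1 - ζ)).re
  have ht : Measurable t := by
    refine Complex.measurable_re.comp (Measurable.div ?_ ?_)
    · exact (measurable_const.add measurable_subtype_coe).const_mul _
    · exact measurable_const.sub measurable_subtype_coe
  have htc : ∀ ζ : sphere (0 : ℂ) 1, ζ ≠ o → (t ζ : ℂ) = Complex.I * (1 + ζ) / (1 - ζ) := by
    intro ζ hζ
    have h1 : Complex.normSq (ζ : ℂ) = 1 := by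
      have : ‖(ζ : ℂ)‖ = 1 := by simp
      rw [Complex.normSq_eq_norm_sq, this, one_pow]
    apply Complex.ext
    · simp [t]
    · rw [Complex.ofReal_im]
      simp only [Complex.div_im, Complex.mul_im, Complex.mul_re, Complex.I_re, Complex.I_im,
        Complex.add_re, Complex.add_im, Complex.sub_re, Complex.sub_im, Complex.one_re,
        Complex.one_im]
      rw [← sub_div, eq_comm, div_eq_zero_iff]
      left
      rw [Complex.normSq_apply] at h1
      linear_combination -h1
  let κ : Measure ℝ := (ν.restrict {o}ᶜ).map t
  have hκ : IsFiniteMeasure κ := inferInstance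
  have hdm : Measurable fun x : ℝ => ENNReal.ofReal (1 + x ^ 2) := by fun_prop
  -- The density turns the line kernel into (1 + x z) / (x - z), which is i times the disc kernel.
  -- The constant is i · (i Im F(0)).
  refine ⟨ν.real {o}, -(F 0).im, κ.withDensity fun x => ENNReal.ofReal (1 + x ^ 2),
    measureReal_nonneg, ?_, ?_⟩
  · rw [lintegral_withDensity_eq_lintegral_mul _ hdm (by fun_prop)]
    have : ∀ x : ℝ, ((fun x : ℝ => ENNReal.ofReal (1 + x ^ 2)) *
        fun x : ℝ => ENNReal.ofReal (1 / (1 + x ^ 2))) x = 1 := by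
      intro x
      rw [Pi.mul_apply, ← ENNReal.ofReal_mul (by positivity), mul_one_div_cancel (by positivity),
        ENNReal.ofReal_one]
    simp_rw [this]
    simp [measure_lt_top]
  · intro z hz
    have hzI : z + Complex.I ≠ 0 := by
      intro h
      have := congrArg Complex.im h
      simp at this
      linarith
    let w : ℂ := (z - Complex.I) / (z + Complex.I)
    have hw : w ∈ ball (0 : ℂ) 1 := by
      rw [mem_ball, dist_zero_right, norm_div, div_lt_one (norm_pos_iff.2 hzI),
        ← sq_lt_sq₀ (norm_nonneg _) (norm_nonneg _), ← Complex.normSq_eq_norm_sq,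
        ← Complex.normSq_eq_norm_sq, Complex.normSq_apply, Complex.normSq_apply]
      simp
      nlinarith
    have hcw : c w = z := by
      have h1 : 1 - w = 2 * Complex.I / (z + Complex.I) := by
        simp only [w]; field_simp; ring
      have h2 : 1 + w = 2 * z / (z + Complex.I) := by
        simp only [w]; field_simp; ring
      have hI : Complex.I ≠ 0 := Complex.I_ne_zero
      simp only [c]
      rw [h1, h2]
      field_simp
    have hfz : f z = Complex.I * F w := by
      simp only [F, hcw]
      rw [← mul_assoc, mul_neg, Complex.I_mul_I]
      ring
    have hKc : Continuous fun ζ : sphere (0 : ℂ) 1 => herglotzRieszKernel 0 w ζ := by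
      have : ContinuousOn (herglotzRieszKernel 0 w) (sphere 0 1) := by
        simpa using continuousOn_herglotzRieszKernel_sphere hw
      exact continuousOn_iff_continuous_domRestrict.1 this
    have hKi : Integrable (fun ζ : sphere (0 : ℂ) 1 => herglotzRieszKernel 0 w ζ) ν :=
      hKc.integrable_of_hasCompactSupport (HasCompactSupport.of_compactSpace _)
    have hatom : Complex.I * ∫ ζ in {o}, herglotzRieszKernel 0 w ζ ∂ν = ν.real {o} * z := by
      rw [integral_singleton]
      have h1 : (1 : ℂ) - w ≠ 0 := hne w hw
      have h2 : Complex.I * herglotzRieszKernel 0 w (o : sphere (0 : ℂ) 1) = z := by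
        rw [← hcw]
        simp [herglotzRieszKernel_def, o, c, mul_div_assoc]
      rw [Complex.real_smul, mul_left_comm, h2]
    have hrest : Complex.I * ∫ ζ in {o}ᶜ, herglotzRieszKernel 0 w ζ ∂ν
        = ∫ x : ℝ, (1 / ((x : ℂ) - z) - (x : ℂ) / ((x : ℂ) ^ 2 + 1))
          ∂(κ.withDensity fun x => ENNReal.ofReal (1 + x ^ 2)) := by
      rw [integral_withDensity_eq_integral_toReal_smul hdm (by simp)]
      rw [integral_map ht.aemeasurable (Measurable.aestronglyMeasurable (by fun_prop)),
        ← integral_const_mul]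
      apply setIntegral_congr_fun (measurableSet_singleton o).compl
      intro ζ hζ
      have hζ' : ζ ≠ o := hζ
      have e := htc ζ hζ'
      have n1 : (1 : ℂ) - ζ ≠ 0 := by
        intro h
        rw [sub_eq_zero] at h
        exact hζ' (Subtype.ext h.symm)
      have n2 : (t ζ : ℂ) - z ≠ 0 := by
        intro h
        have := congrArg Complex.im h
        simp at this
        linarith
      have n3 : (t ζ : ℂ) ^ 2 + 1 ≠ 0 := by
        have : (0 : ℝ) < t ζ ^ 2 + 1 := by positivity
        exact_mod_cast this.ne'
      have n4 : (ζ : ℂ) - w ≠ 0 := by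
        intro h
        rw [sub_eq_zero] at h
        have h1 : ‖(ζ : ℂ)‖ = 1 := by simp
        rw [h] at h1
        simp at hw
        linarith
      have hζt : (ζ : ℂ) * (t ζ + Complex.I) = t ζ - Complex.I := by
        rw [eq_div_iff n1] at e
        linear_combination -e
      have hwz : w * (z + Complex.I) = z - Complex.I := div_mul_cancel₀ _ hzI
      have n5 : (t ζ : ℂ) + Complex.I ≠ 0 := by
        intro h
        have := congrArg Complex.im h
        simp at this
      simp only [herglotzRieszKernel_def, sub_zero]
      rw [ENNReal.toReal_ofReal (by positivity), Complex.real_smul]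
      have hR : ((1 + t ζ ^ 2 : ℝ) : ℂ) * (1 / ((t ζ : ℂ) - z) - t ζ / ((t ζ : ℂ) ^ 2 + 1))
          = (1 + t ζ * z) / (t ζ - z) := by
        push_cast
        field_simp
        ring
      rw [hR, mul_div_assoc', div_eq_div_iff n4 n2]
      have hI2 : Complex.I ^ 2 = -1 := Complex.I_sq
      -- This factor clears the denominators of ζ and w, written as Cayley images of t and z.
      apply mul_right_cancel₀ (mul_ne_zero n5 hzI)
      rw [show Complex.I * ((ζ : ℂ) + w) * (t ζ - z) * ((t ζ + Complex.I) * (z + Complex.I))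
        = Complex.I * ((ζ * (t ζ + Complex.I)) * (z + Complex.I)
          + (w * (z + Complex.I)) * (t ζ + Complex.I)) * (t ζ - z) by ring,
        show (1 + t ζ * z) * ((ζ : ℂ) - w) * ((t ζ + Complex.I) * (z + Complex.I))
        = (1 + t ζ * z) * ((ζ * (t ζ + Complex.I)) * (z + Complex.I)
          - (w * (z + Complex.I)) * (t ζ + Complex.I)) by ring, hζt, hwz]
      linear_combination (-2 * Complex.I * (t ζ - z)) * hI2
    rw [hfz, hrep w hw, ← integral_add_compl (measurableSet_singleton o) hKi, mul_add, mul_add,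
      hatom, hrest]
    rw [mul_left_comm, Complex.I_mul_I]
    push_cast
    ring

/-! ### The functions g_r and the Poisson kernel -/

theorem herglotzShift_im (h : ℂ → ℂ) (r : ℝ) (z : ℂ) :
    (herglotzShift h r z).im = (h z).im / ((r - (h z).re) ^ 2 + (h z).im ^ 2) := by
  simp only [herglotzShift, Complex.inv_im, Complex.normSq_apply]
  simp
  ring

theorem isHerglotz_herglotzShift {h : ℂ → ℂ} (hh : IsHerglotz h) (r : ℝ) :
    IsHerglotz (herglotzShift h r) where
  differentiableOn := by
    refine ((differentiableOn_const _).sub hh.differentiableOn).inv ?_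
    intro z hz h0
    have h1 : 0 < (h z).im := hh.mapsTo hz
    have := congrArg Complex.im h0
    simp at this
    linarith
  mapsTo := by
    intro z hz
    have h1 : 0 < (h z).im := hh.mapsTo hz
    simp only [Set.mem_ofPred_eq]
    rw [herglotzShift_im]
    positivity

/-- The Poisson kernel `y / ((t - x) ^ 2 + y ^ 2) / π` of the upper half-plane. -/
noncomputable def halfPlaneKernel (x y t : ℝ) : ℝ := y / ((t - x) ^ 2 + y ^ 2) / Real.pi

/-- The Poisson integral of the measure `μ` at the point `x + i y`. -/
noncomputable def poissonIntegral (μ : Measure ℝ) (x y : ℝ) : ℝ≥0∞ :=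
  ∫⁻ t, ENNReal.ofReal (halfPlaneKernel x y t) ∂μ

theorem halfPlaneKernel_nonneg {y : ℝ} (hy : 0 ≤ y) (x t : ℝ) : 0 ≤ halfPlaneKernel x y t := by
  unfold halfPlaneKernel
  positivity

theorem halfPlaneKernel_comm (x y t : ℝ) : halfPlaneKernel x y t = halfPlaneKernel t y x := by
  unfold halfPlaneKernel
  rw [show (t - x) ^ 2 = (x - t) ^ 2 by ring]

theorem Measurable.halfPlaneKernel {α : Type*} [MeasurableSpace α] {a b c : α → ℝ}
    (ha : Measurable a) (hb : Measurable b) (hc : Measurable c) :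
    Measurable fun i => halfPlaneKernel (a i) (b i) (c i) := by
  unfold _root_.halfPlaneKernel
  fun_prop

theorem continuous_halfPlaneKernel {y : ℝ} (hy : 0 < y) (x : ℝ) :
    Continuous (halfPlaneKernel x y) := by
  unfold halfPlaneKernel
  exact ((continuous_const.div (by fun_prop) (fun t => by positivity)).div_const _)

theorem halfPlaneKernel_add_mul {y : ℝ} (hy : 0 < y) (x s : ℝ) :
    y * halfPlaneKernel x y (x + y * s) = (1 + s ^ 2)⁻¹ / Real.pi := by
  unfold halfPlaneKernel
  have := Real.pi_pos
  rw [show (x + y * s - x) ^ 2 + y ^ 2 = y ^ 2 * (1 + s ^ 2) by ring]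
  field_simp

theorem integral_mul_halfPlaneKernel {y : ℝ} (hy : 0 < y) (g : ℝ → ℝ) (x : ℝ) :
    ∫ t, g t * halfPlaneKernel x y t = ∫ s, g (x + y * s) * ((1 + s ^ 2)⁻¹ / Real.pi) := by
  rw [← integral_add_left_eq_self (fun t => g t * halfPlaneKernel x y t) x]
  have := Measure.integral_comp_mul_left
    (fun t => g (x + t) * halfPlaneKernel x y (x + t)) y
  rw [abs_of_pos (inv_pos.2 hy), smul_eq_mul, eq_inv_mul_iff_mul_eq₀ hy.ne'] at this
  rw [← this, ← integral_const_mul]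
  congr 1
  ext s
  rw [← halfPlaneKernel_add_mul hy x s]
  ring

theorem integrable_halfPlaneKernel {y : ℝ} (hy : 0 < y) (x : ℝ) :
    Integrable (halfPlaneKernel x y) := by
  have h1 : Integrable fun s : ℝ => (1 + s ^ 2)⁻¹ / Real.pi / y :=
    (integrable_inv_one_add_sq.div_const _).div_const _
  have h2 : Integrable fun s : ℝ => halfPlaneKernel x y (x + y * s) := by
    convert h1 using 2 with s
    rw [← halfPlaneKernel_add_mul hy x s]
    field_simp
  have h3 : Integrable fun s : ℝ => halfPlaneKernel x y (x + s) :=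
    (integrable_comp_mul_left_iff (fun s => halfPlaneKernel x y (x + s)) hy.ne').1 h2
  convert h3.comp_sub_right x using 2 with s
  congr 1
  ring

theorem integral_halfPlaneKernel {y : ℝ} (hy : 0 < y) (x : ℝ) :
    ∫ t, halfPlaneKernel x y t = 1 := by
  have := integral_mul_halfPlaneKernel hy (fun _ => 1) x
  simp only [one_mul] at this
  rw [this, integral_div, integral_univ_inv_one_add_sq, div_self Real.pi_ne_zero]

/-! ### Imaginary parts as Poisson integrals -/

namespace IsHerglotzTriple

variable {f : ℂ → ℂ} {α β : ℝ} {μ : Measure ℝ}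

theorem integrable_inv (hf : IsHerglotzTriple f α β μ) :
    Integrable (fun x : ℝ => 1 / (1 + x ^ 2)) μ := by
  refine ⟨Measurable.aestronglyMeasurable (by fun_prop), ?_⟩
  rw [hasFiniteIntegral_iff_ofReal (ae_of_all _ fun x => by positivity)]
  exact hf.lintegral_lt_top

/-- Chebyshev's inequality, as the weight 1 / (1 + t²) is bounded below on the unit ball about x. -/
theorem isLocallyFiniteMeasure (hf : IsHerglotzTriple f α β μ) : IsLocallyFiniteMeasure μ := by
  refine ⟨fun x => ⟨{t | ENNReal.ofReal (1 / (1 + (|x| + 1) ^ 2))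
    ≤ ENNReal.ofReal (1 / (1 + t ^ 2))}, ?_, ?_⟩⟩
  · filter_upwards [Metric.ball_mem_nhds x one_pos] with t ht
    rw [Metric.mem_ball, Real.dist_eq] at ht
    apply ENNReal.ofReal_le_ofReal
    apply one_div_le_one_div_of_le (by positivity)
    have h1 : |t| ≤ |x| + 1 := by
      have := abs_sub_abs_le_abs_sub t x
      linarith
    have h2 : t ^ 2 ≤ (|x| + 1) ^ 2 := by
      rw [← sq_abs t]
      gcongr
    linarith
  · refine (meas_ge_le_lintegral_div (Measurable.aemeasurable (by fun_prop)) ?_ (by simp)).trans_lt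
      (ENNReal.div_lt_top hf.lintegral_lt_top.ne ?_)
    · simp only [ne_eq, ENNReal.ofReal_eq_zero, not_le]; positivity
    · simp only [ne_eq, ENNReal.ofReal_eq_zero, not_le]; positivity

/-- The kernel equals (z + (1 + z²) / (x - z)) / (1 + x²), and |x - z| ≥ Im z. -/
theorem integrable_kernel (hf : IsHerglotzTriple f α β μ) {z : ℂ} (hz : 0 < z.im) :
    Integrable (fun x : ℝ => 1 / ((x : ℂ) - z) - (x : ℂ) / ((x : ℂ) ^ 2 + 1)) μ := by
  refine (hf.integrable_inv.const_mul (‖z‖ + ‖1 + z ^ 2‖ / z.im)).mono'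
    (Measurable.aestronglyMeasurable (by fun_prop)) (ae_of_all _ fun x => ?_)
  have n2 : (x : ℂ) - z ≠ 0 := by
    intro h
    have := congrArg Complex.im h
    simp at this
    linarith
  have n3 : (x : ℂ) ^ 2 + 1 ≠ 0 := by
    have : (0 : ℝ) < x ^ 2 + 1 := by positivity
    exact_mod_cast this.ne'
  have e : 1 / ((x : ℂ) - z) - (x : ℂ) / ((x : ℂ) ^ 2 + 1)
      = (z + (1 + z ^ 2) / (x - z)) * ((1 / (1 + x ^ 2) : ℝ) : ℂ) := by
    have n4 : (1 : ℂ) + x ^ 2 ≠ 0 := by rwa [add_comm] at n3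
    push_cast
    field_simp
    ring
  rw [e, norm_mul, Complex.norm_real, Real.norm_of_nonneg (by positivity)]
  gcongr
  refine (norm_add_le _ _).trans ?_
  rw [norm_div]
  gcongr
  have := Complex.abs_im_le_norm ((x : ℂ) - z)
  simp only [Complex.sub_im, Complex.ofReal_im, zero_sub, abs_neg] at this
  exact (le_abs_self _).trans this

/-- The compensating term x / (x² + 1) and β are real, so only Im (1 / (t - z)), which is π times
the Poisson kernel, and the linear term survive. -/
theorem im_eq (hf : IsHerglotzTriple f α β μ) {y : ℝ} (hy : 0 < y) (x : ℝ) :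
    (f (x + y * Complex.I)).im / Real.pi = α * y / Real.pi + ∫ t, halfPlaneKernel x y t ∂μ := by
  have hz : 0 < (x + y * Complex.I : ℂ).im := by simpa
  have hi := hf.integrable_kernel hz
  rw [hf.eq _ hz]
  rw [Complex.add_im, ← Complex.imCLM_apply (∫ _, _ ∂μ),
    ← ContinuousLinearMap.integral_comp_comm _ hi]
  have e : ∀ t : ℝ, Complex.imCLM (1 / ((t : ℂ) - (x + y * Complex.I))
      - (t : ℂ) / ((t : ℂ) ^ 2 + 1)) = Real.pi * halfPlaneKernel x y t := by
    intro t
    have h1 : (t : ℂ) / ((t : ℂ) ^ 2 + 1) = ((t / (t ^ 2 + 1) : ℝ) : ℂ) := by push_cast; ring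
    rw [Complex.imCLM_apply, Complex.sub_im, h1, Complex.ofReal_im, sub_zero, one_div,
      Complex.inv_im, Complex.normSq_apply]
    simp only [halfPlaneKernel]
    have := Real.pi_pos
    simp
    field_simp
  simp_rw [e]
  rw [integral_const_mul, add_div, mul_div_cancel_left₀ _ Real.pi_ne_zero]
  simp

theorem integrable_halfPlaneKernel (hf : IsHerglotzTriple f α β μ) {y : ℝ} (hy : 0 < y) (x : ℝ) :
    Integrable (halfPlaneKernel x y) μ := by
  have h := (hf.integrable_kernel (z := x + y * Complex.I) (by simpa)).im
  refine (h.div_const Real.pi).congr (ae_of_all _ fun t => ?_)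
  have h1 : (t : ℂ) / ((t : ℂ) ^ 2 + 1) = ((t / (t ^ 2 + 1) : ℝ) : ℂ) := by push_cast; ring
  simp only [RCLike.im_to_complex]
  rw [Complex.sub_im, h1, Complex.ofReal_im, sub_zero, one_div,
    Complex.inv_im, Complex.normSq_apply]
  simp only [halfPlaneKernel]
  simp
  ring

theorem ofReal_im_eq (hf : IsHerglotzTriple f α β μ) {y : ℝ} (hy : 0 < y) (x : ℝ) :
    ENNReal.ofReal ((f (x + y * Complex.I)).im / Real.pi)
      = ENNReal.ofReal (α / Real.pi) * ENNReal.ofReal y + poissonIntegral μ x y := by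
  have := hf.nonneg
  rw [hf.im_eq hy x, ENNReal.ofReal_add (by positivity)
    (integral_nonneg fun t => halfPlaneKernel_nonneg hy.le x t), poissonIntegral,
    ofReal_integral_eq_lintegral_ofReal (hf.integrable_halfPlaneKernel hy x)
    (ae_of_all _ fun t => halfPlaneKernel_nonneg hy.le x t), ← ENNReal.ofReal_mul (by positivity)]
  congr 2
  ring

end IsHerglotzTriple

/-! ### Stieltjes inversion and uniqueness -/

open Filter Topology in
/-- The Poisson integral of a continuous function of compact support converges to it. -/
theorem tendsto_integral_mul_halfPlaneKernel {φ : ℝ → ℝ} (hφ : Continuous φ)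
    (hc : HasCompactSupport φ) {y : ℕ → ℝ} (hy : ∀ n, 0 < y n) (hy0 : Tendsto y atTop (𝓝 0))
    (t : ℝ) : Tendsto (fun n => ∫ x, φ x * halfPlaneKernel t (y n) x) atTop (𝓝 (φ t)) := by
  obtain ⟨M, hM⟩ := hc.exists_bound_of_continuous hφ
  -- Rescaling moves y into the argument of φ and leaves the fixed Cauchy density for domination.
  simp_rw [fun n => integral_mul_halfPlaneKernel (hy n) φ t]
  have hlim : φ t = ∫ s : ℝ, φ t * ((1 + s ^ 2)⁻¹ / Real.pi) := by
    rw [integral_const_mul, integral_div, integral_univ_inv_one_add_sq,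
      div_self Real.pi_ne_zero, mul_one]
  rw [hlim]
  refine tendsto_integral_of_dominated_convergence (fun s => M * ((1 + s ^ 2)⁻¹ / Real.pi))
    (fun n => ?_) ((integrable_inv_one_add_sq.div_const _).const_mul _) (fun n => ?_) ?_
  · exact Measurable.aestronglyMeasurable (by have := hφ.measurable; fun_prop)
  · refine ae_of_all _ fun s => ?_
    have : 0 ≤ (1 + s ^ 2)⁻¹ / Real.pi := by positivity
    rw [norm_mul, Real.norm_of_nonneg this]
    exact mul_le_mul_of_nonneg_right (hM _) this
  · refine ae_of_all _ fun s => ?_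
    refine Tendsto.mul_const _ ((hφ.tendsto t).comp ?_)
    simpa using (hy0.mul_const s).const_add t

/-- The Poisson integral of a continuous function of compact support decays quadratically,
uniformly near the boundary. -/
theorem exists_abs_integral_mul_halfPlaneKernel_le {φ : ℝ → ℝ} (hφ : Continuous φ)
    (hc : HasCompactSupport φ) : ∃ C : ℝ, ∀ y : ℝ, 0 < y → y ≤ 1 → ∀ t : ℝ,
      |∫ x, φ x * halfPlaneKernel t y x| ≤ C * (1 / (1 + t ^ 2)) := by
  have hφi : Integrable φ := hφ.integrable_of_hasCompactSupport hc
  obtain ⟨M, hM⟩ := (hc.mul_left (f := fun x => 1 + 2 * x ^ 2)).exists_bound_of_continuous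
    (by fun_prop)
  -- From 1 + t² ≤ (1 + 2x²) + 2(x - t)²: the first part meets a kernel of mass 1, the second
  -- cancels the decay of the kernel, since y ≤ 1.
  refine ⟨M + ∫ x, 2 * |φ x|, fun y hy hy1 t => ?_⟩
  rw [mul_one_div, le_div_iff₀ (by positivity), mul_comm,
    ← abs_of_pos (show 0 < 1 + t ^ 2 by positivity), ← abs_mul, ← integral_const_mul]
  have h1 : Integrable fun x => M * halfPlaneKernel t y x :=
    (integrable_halfPlaneKernel hy t).const_mul _
  have h2 : Integrable fun x => 2 * |φ x| := hφi.abs.const_mul 2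
  have e : M + ∫ x, 2 * |φ x| = ∫ x, (M * halfPlaneKernel t y x + 2 * |φ x|) := by
    rw [integral_add h1 h2, integral_const_mul M, integral_halfPlaneKernel hy, mul_one]
  rw [e, ← Real.norm_eq_abs]
  refine norm_integral_le_of_norm_le (h1.fun_add h2) (ae_of_all _ fun x => ?_)
  have hk := halfPlaneKernel_nonneg hy.le t x
  have hk2 : (x - t) ^ 2 * halfPlaneKernel t y x ≤ 1 := by
    have hpi : 1 ≤ Real.pi := by linarith [Real.pi_gt_three]
    have hd : 0 < (x - t) ^ 2 + y ^ 2 := by positivity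
    unfold halfPlaneKernel
    rw [mul_div_assoc', div_le_one (by positivity), mul_div_assoc', div_le_iff₀ hd]
    nlinarith [sq_nonneg (x - t), mul_nonneg (sq_nonneg (x - t)) (sub_nonneg.2 hy1),
      mul_nonneg (sub_nonneg.2 hpi) hd.le, sq_nonneg y]
  have hMx := hM x
  rw [Real.norm_eq_abs, Pi.mul_apply, abs_mul,
    abs_of_pos (show 0 < 1 + 2 * x ^ 2 by positivity)] at hMx
  rw [Real.norm_eq_abs, abs_mul, abs_mul, abs_of_nonneg hk,
    abs_of_pos (show 0 < 1 + t ^ 2 by positivity)]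
  have h3 : 1 + t ^ 2 ≤ (1 + 2 * x ^ 2) + 2 * (x - t) ^ 2 := by nlinarith [sq_nonneg (2 * x - t)]
  calc (1 + t ^ 2) * (|φ x| * halfPlaneKernel t y x)
      ≤ ((1 + 2 * x ^ 2) + 2 * (x - t) ^ 2) * (|φ x| * halfPlaneKernel t y x) := by gcongr
    _ = ((1 + 2 * x ^ 2) * |φ x|) * halfPlaneKernel t y x
        + 2 * |φ x| * ((x - t) ^ 2 * halfPlaneKernel t y x) := by ring
    _ ≤ M * halfPlaneKernel t y x + 2 * |φ x| * 1 := by gcongr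
    _ = M * halfPlaneKernel t y x + 2 * |φ x| := by ring

namespace IsHerglotzTriple

variable {f : ℂ → ℂ} {α β : ℝ} {μ : Measure ℝ}

/-- For fixed y the kernel is at most a polynomial in x times 1 / (1 + t²), so a product function
dominates. This licenses Fubini in the inversion formula. -/
theorem integrable_prod (hf : IsHerglotzTriple f α β μ) {φ : ℝ → ℝ} (hφ : Continuous φ)
    (hc : HasCompactSupport φ) {y : ℝ} (hy : 0 < y) :
    Integrable (fun p : ℝ × ℝ => φ p.1 * halfPlaneKernel p.1 y p.2) (volume.prod μ) := by
  have := hf.isLocallyFiniteMeasure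
  have hi : Integrable fun x => (2 + (1 + 2 * x ^ 2) / y ^ 2) * φ x := by
    refine Continuous.integrable_of_hasCompactSupport (by fun_prop) ?_
    exact hc.mul_left (f := fun x => 2 + (1 + 2 * x ^ 2) / y ^ 2)
  refine ((hi.norm.mul_prod hf.integrable_inv).const_mul (y / Real.pi)).mono'
    (Measurable.aestronglyMeasurable ((hφ.measurable.comp measurable_fst).mul
      (measurable_fst.halfPlaneKernel measurable_const measurable_snd)))
    (ae_of_all _ fun p => ?_)
  obtain ⟨x, t⟩ := p
  simp only
  have hd : 0 < (t - x) ^ 2 + y ^ 2 := by positivity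
  have hc0 : 0 ≤ 2 + (1 + 2 * x ^ 2) / y ^ 2 := by positivity
  have h1 : 1 + t ^ 2 ≤ (2 + (1 + 2 * x ^ 2) / y ^ 2) * ((t - x) ^ 2 + y ^ 2) := by
    have h2 : (2 + (1 + 2 * x ^ 2) / y ^ 2) * ((t - x) ^ 2 + y ^ 2)
        = 2 * (t - x) ^ 2 + 2 * y ^ 2 + (1 + 2 * x ^ 2) / y ^ 2 * (t - x) ^ 2
          + (1 + 2 * x ^ 2) := by
      field_simp
      ring
    have h3 : 0 ≤ (1 + 2 * x ^ 2) / y ^ 2 * (t - x) ^ 2 := by positivity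
    nlinarith [sq_nonneg (2 * x - t), sq_nonneg y]
  have h2 : 1 / ((t - x) ^ 2 + y ^ 2) ≤ (2 + (1 + 2 * x ^ 2) / y ^ 2) * (1 / (1 + t ^ 2)) := by
    rw [mul_one_div, div_le_div_iff₀ hd (by positivity)]
    linarith
  rw [norm_mul, Real.norm_of_nonneg (halfPlaneKernel_nonneg hy.le x t), norm_mul,
    Real.norm_of_nonneg hc0]
  calc ‖φ x‖ * halfPlaneKernel x y t
      = y / Real.pi * (‖φ x‖ * (1 / ((t - x) ^ 2 + y ^ 2))) := by unfold halfPlaneKernel; ring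
    _ ≤ y / Real.pi * (‖φ x‖ * ((2 + (1 + 2 * x ^ 2) / y ^ 2) * (1 / (1 + t ^ 2)))) := by gcongr
    _ = _ := by ring

open Filter Topology in
/-- **Stieltjes inversion formula**. -/
theorem tendsto_integral (hf : IsHerglotzTriple f α β μ) {φ : ℝ → ℝ} (hφ : Continuous φ)
    (hc : HasCompactSupport φ) {y : ℕ → ℝ} (hy : ∀ n, 0 < y n) (hy1 : ∀ n, y n ≤ 1)
    (hy0 : Tendsto y atTop (𝓝 0)) :
    Tendsto (fun n => ∫ x : ℝ, φ x * ((f (x + y n * Complex.I)).im / Real.pi)) atTop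
      (𝓝 (∫ t, φ t ∂μ)) := by
  have := hf.isLocallyFiniteMeasure
  have hφi : Integrable φ := hφ.integrable_of_hasCompactSupport hc
  -- Fubini and the symmetry of the kernel move the smoothing from μ onto φ.
  have e : ∀ n, ∫ x : ℝ, φ x * ((f (x + y n * Complex.I)).im / Real.pi)
      = (α * y n / Real.pi) * (∫ x, φ x) + ∫ t, (∫ x, φ x * halfPlaneKernel t (y n) x) ∂μ := by
    intro n
    have hp := hf.integrable_prod hφ hc (hy n)
    simp_rw [fun x => hf.im_eq (hy n) x, mul_add]
    rw [integral_add (hφi.mul_const _), integral_mul_const, mul_comm]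
    · congr 1
      simp_rw [← integral_const_mul]
      rw [integral_integral_swap hp]
      simp_rw [fun t x => halfPlaneKernel_comm x (y n) t]
    · simp_rw [← integral_const_mul]
      exact hp.integral_prod_left
  simp_rw [e]
  obtain ⟨C, hC⟩ := exists_abs_integral_mul_halfPlaneKernel_le hφ hc
  have h1 : Tendsto (fun n => (α * y n / Real.pi) * ∫ x, φ x) atTop (𝓝 0) := by
    simpa using (((hy0.const_mul α).div_const Real.pi).mul_const (∫ x, φ x))
  have h2 : Tendsto (fun n => ∫ t, (∫ x, φ x * halfPlaneKernel t (y n) x) ∂μ) atTop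
      (𝓝 (∫ t, φ t ∂μ)) := by
    refine tendsto_integral_of_dominated_convergence (fun t => C * (1 / (1 + t ^ 2)))
      (fun n => ?_) (hf.integrable_inv.const_mul C) (fun n => ae_of_all _ fun t => ?_)
      (ae_of_all _ fun t => tendsto_integral_mul_halfPlaneKernel hφ hc hy hy0 t)
    · have hm : StronglyMeasurable (fun p : ℝ × ℝ => φ p.2 * halfPlaneKernel p.1 (y n) p.2) :=
        ((hφ.measurable.comp measurable_snd).mul
          (measurable_fst.halfPlaneKernel measurable_const measurable_snd)).stronglyMeasurable
      exact hm.integral_prod_right.aestronglyMeasurable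
    · exact hC _ (hy n) (hy1 n) t
  simpa using h1.add h2

end IsHerglotzTriple

open Filter Topology in
theorem tendsto_one_div_nat_succ : Tendsto (fun n : ℕ => 1 / ((n : ℝ) + 1)) atTop (𝓝 0) :=
  tendsto_one_div_add_atTop_nhds_zero_nat

theorem one_div_nat_succ_pos (n : ℕ) : 0 < 1 / ((n : ℝ) + 1) := by positivity

theorem one_div_nat_succ_le_one (n : ℕ) : 1 / ((n : ℝ) + 1) ≤ 1 := by
  rw [div_le_one (by positivity)]
  linarith [(n.cast_nonneg : (0 : ℝ) ≤ n)]

theorem IsHerglotzMeasure.unique {f : ℂ → ℂ} {μ ν : Measure ℝ} (hμ : IsHerglotzMeasure f μ)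
    (hν : IsHerglotzMeasure f ν) : μ = ν := by
  obtain ⟨α, β, h⟩ := hμ
  obtain ⟨α', β', h'⟩ := hν
  have := h.isLocallyFiniteMeasure
  have := h'.isLocallyFiniteMeasure
  refine Measure.ext_of_integral_eq_on_compactlySupported fun φ => ?_
  exact tendsto_nhds_unique
    (h.tendsto_integral φ.continuous φ.hasCompactSupport one_div_nat_succ_pos
      one_div_nat_succ_le_one tendsto_one_div_nat_succ)
    (h'.tendsto_integral φ.continuous φ.hasCompactSupport one_div_nat_succ_pos
      one_div_nat_succ_le_one tendsto_one_div_nat_succ)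

/-! ### Measurable families of measures -/

theorem measure_eq_iSup_inter_Ioo (μ : Measure ℝ) (s : Set ℝ) :
    μ s = ⨆ N : ℕ, μ (s ∩ Set.Ioo (-(N : ℝ)) N) := by
  have hmono : Monotone fun N : ℕ => s ∩ Set.Ioo (-(N : ℝ)) N := by
    intro m n hmn
    have : (m : ℝ) ≤ n := by exact_mod_cast hmn
    exact Set.inter_subset_inter_right _ (Set.Ioo_subset_Ioo (by linarith) this)
  rw [← hmono.measure_iUnion, ← Set.inter_iUnion]
  congr 1
  rw [eq_comm, Set.inter_eq_left]
  intro x _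
  obtain ⟨N, hN⟩ := exists_nat_gt |x|
  exact Set.mem_iUnion.2 ⟨N, abs_lt.1 hN⟩

open Filter Topology in
/-- A family of locally finite measures on the line is measurable as soon as the integrals of
continuous functions of compact support are. -/
theorem measurable_measure_of_integral {ι : Type*} [MeasurableSpace ι] {μ : ι → Measure ℝ}
    (hμ : ∀ r, IsLocallyFiniteMeasure (μ r))
    (h : ∀ φ : ℝ → ℝ, Continuous φ → HasCompactSupport φ → Measurable fun r => ∫ t, φ t ∂(μ r)) :
    Measurable μ := by
  have hIoo : ∀ a b : ℝ, Measurable fun r => μ r (Set.Ioo a b) := by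
    intro a b
    -- Trapezoids supported in [a, b] that converge pointwise to the indicator of (a, b).
    let φ : ℕ → ℝ → ℝ := fun n x => max 0 (min 1 (n * min (x - a) (b - x)))
    have hφ : ∀ n, Continuous (φ n) := fun n => by fun_prop
    have h0 : ∀ n x, x ∉ Set.Ioo a b → φ n x = 0 := by
      intro n x hx
      have h1 : min (x - a) (b - x) ≤ 0 := by
        by_contra! hlt
        rw [lt_min_iff] at hlt
        exact hx ⟨by linarith, by linarith⟩
      simp only [φ]
      rw [max_eq_left]
      exact (min_le_right _ _).trans (mul_nonpos_of_nonneg_of_nonpos n.cast_nonneg h1)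
    have hc : ∀ n, HasCompactSupport (φ n) := fun n =>
      HasCompactSupport.intro (isCompact_Icc (a := a) (b := b)) fun x hx =>
        h0 n x (fun h => hx (Set.Ioo_subset_Icc_self h))
    have hlim : ∀ r, Tendsto (fun n => ∫ t, φ n t ∂(μ r)) atTop
        (𝓝 ((μ r).real (Set.Ioo a b))) := by
      intro r
      have := hμ r
      rw [← integral_indicator_one measurableSet_Ioo]
      refine tendsto_integral_of_dominated_convergence ((Set.Ioo a b).indicator 1)
        (fun n => (hφ n).aestronglyMeasurable) ?_ (fun n => ae_of_all _ fun x => ?_)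
        (ae_of_all _ fun x => ?_)
      · exact (integrable_indicator_iff measurableSet_Ioo).2
          (integrableOn_const (measure_Ioo_lt_top.ne))
      · by_cases hx : x ∈ Set.Ioo a b
        · rw [Set.indicator_of_mem hx, Real.norm_of_nonneg (le_max_left _ _)]
          exact max_le zero_le_one (min_le_left _ _)
        · rw [h0 n x hx, Set.indicator_of_notMem hx, norm_zero]
      · by_cases hx : x ∈ Set.Ioo a b
        · rw [Set.indicator_of_mem hx]
          have hp : 0 < min (x - a) (b - x) := lt_min (by linarith [hx.1]) (by linarith [hx.2])
          refine tendsto_const_nhds.congr' ?_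
          have := (tendsto_natCast_atTop_atTop (R := ℝ)).atTop_mul_const hp
          filter_upwards [this.eventually_ge_atTop 1] with n hn
          simp [φ, min_eq_left hn]
        · simp_rw [h0 _ x hx, Set.indicator_of_notMem hx]
          exact tendsto_const_nhds
    have hm : Measurable fun r => (μ r).real (Set.Ioo a b) :=
      measurable_of_tendsto_metrizable (fun n => h _ (hφ n) (hc n)) (tendsto_pi_nhds.2 hlim)
    convert ENNReal.measurable_ofReal.comp hm using 1
    ext r
    have := hμ r
    exact (ENNReal.ofReal_toReal measure_Ioo_lt_top.ne).symm
  -- Truncation makes the measures finite, as the π-system argument requires.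
  have hN : ∀ N : ℕ, Measurable fun r => (μ r).restrict (Set.Ioo (-(N : ℝ)) N) := by
    intro N
    have hfin : ∀ r, IsFiniteMeasure ((μ r).restrict (Set.Ioo (-(N : ℝ)) N)) := by
      intro r
      have := hμ r
      exact ⟨by simpa using measure_Ioo_lt_top⟩
    refine Measurable.measure_of_isPiSystem
      ((BorelSpace.measurable_eq (α := ℝ)).trans Real.borel_eq_generateFrom_Ioo_rat)
      Real.isPiSystem_Ioo_rat ?_ ?_
    · intro s hs
      simp only [Set.mem_iUnion, Set.mem_singleton_iff] at hs
      obtain ⟨l, u, -, rfl⟩ := hs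
      simp_rw [Measure.restrict_apply measurableSet_Ioo, Set.Ioo_inter_Ioo]
      exact hIoo _ _
    · simpa using hIoo _ _
  refine Measure.measurable_of_measurable_coe _ fun s hs => ?_
  simp_rw [measure_eq_iSup_inter_Ioo _ s]
  refine Measurable.iSup fun N => ?_
  have := (Measure.measurable_coe hs).comp (hN N)
  simpa [Function.comp_def, Measure.restrict_apply hs] using this

/-! ### Fatou's theorem: vertical limits of Poisson integrals -/

open Metric in
/-- Radially decreasing kernels preserve domination on all centred balls. -/
theorem poissonIntegral_mono_of_closedBall {m₁ m₂ : Measure ℝ} {x y : ℝ} (hy : 0 < y)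
    (h : ∀ R, 0 ≤ R → m₁ (closedBall x R) ≤ m₂ (closedBall x R)) :
    poissonIntegral m₁ x y ≤ poissonIntegral m₂ x y := by
  unfold poissonIntegral
  have hm : Measurable (halfPlaneKernel x y) := (continuous_halfPlaneKernel hy x).measurable
  rw [lintegral_eq_lintegral_meas_le m₁ (ae_of_all _ (halfPlaneKernel_nonneg hy.le x))
      hm.aemeasurable,
    lintegral_eq_lintegral_meas_le m₂ (ae_of_all _ (halfPlaneKernel_nonneg hy.le x))
      hm.aemeasurable]
  refine setLIntegral_mono_ae' measurableSet_Ioi (ae_of_all _ fun t (ht : 0 < t) => ?_)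
  have hpi := Real.pi_pos
  -- In the layer-cake formula the superlevel sets of the kernel are centred closed balls or empty.
  have key : ∀ s, t ≤ halfPlaneKernel x y s ↔ (s - x) ^ 2 ≤ y / (Real.pi * t) - y ^ 2 := by
    intro s
    unfold halfPlaneKernel
    rw [le_div_iff₀ hpi, le_div_iff₀ (by positivity), le_sub_iff_add_le,
      le_div_iff₀ (by positivity)]
    rw [show t * Real.pi * ((s - x) ^ 2 + y ^ 2) = ((s - x) ^ 2 + y ^ 2) * (Real.pi * t) by ring]
  simp_rw [key]
  by_cases hq : 0 ≤ y / (Real.pi * t) - y ^ 2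
  · have : {s | (s - x) ^ 2 ≤ y / (Real.pi * t) - y ^ 2}
        = closedBall x (Real.sqrt (y / (Real.pi * t) - y ^ 2)) := by
      ext s
      rw [Set.mem_ofPred_eq, mem_closedBall, Real.dist_eq]
      exact ⟨Real.abs_le_sqrt, fun h => by
        simpa [sq_abs, Real.sq_sqrt hq] using pow_le_pow_left₀ (abs_nonneg _) h 2⟩
    rw [this]
    exact h _ (Real.sqrt_nonneg _)
  · have : {s | (s - x) ^ 2 ≤ y / (Real.pi * t) - y ^ 2} = ∅ := by
      ext s
      simp only [Set.mem_ofPred_eq, Set.mem_empty_iff_false, iff_false, not_le]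
      nlinarith [sq_nonneg (s - x)]
    simp [this]

theorem poissonIntegral_volume {y : ℝ} (hy : 0 < y) (x : ℝ) : poissonIntegral volume x y = 1 := by
  unfold poissonIntegral
  rw [← ofReal_integral_eq_lintegral_ofReal (integrable_halfPlaneKernel hy x)
    (ae_of_all _ (halfPlaneKernel_nonneg hy.le x)), integral_halfPlaneKernel hy,
    ENNReal.ofReal_one]

theorem poissonIntegral_smul (c : ℝ≥0∞) (μ : Measure ℝ) (x y : ℝ) :
    poissonIntegral (c • μ) x y = c * poissonIntegral μ x y := by
  unfold poissonIntegral
  rw [lintegral_smul_measure, smul_eq_mul]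

theorem poissonIntegral_restrict_add_compl (μ : Measure ℝ) (x y : ℝ) {s : Set ℝ}
    (hs : MeasurableSet s) :
    poissonIntegral (μ.restrict s) x y + poissonIntegral (μ.restrict sᶜ) x y
      = poissonIntegral μ x y :=
  lintegral_add_compl _ hs

open Metric Filter Topology in
/-- The part of a measure away from `x` does not contribute to boundary values at `x`. -/
theorem tendsto_poissonIntegral_restrict_compl {μ : Measure ℝ}
    (hμ : ∫⁻ t : ℝ, ENNReal.ofReal (1 / (1 + t ^ 2)) ∂μ < ∞) (x : ℝ) {δ : ℝ} (hδ : 0 < δ) :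
    Tendsto (fun y => poissonIntegral (μ.restrict (closedBall x δ)ᶜ) x y) (𝓝[>] 0) (𝓝 0) := by
  let c : ℝ := (1 + 2 * x ^ 2) / δ ^ 2 + 2
  have hc : 0 < c := by positivity
  have hb : ∀ y, 0 < y → poissonIntegral (μ.restrict (closedBall x δ)ᶜ) x y
      ≤ ENNReal.ofReal (y * c / Real.pi) * ∫⁻ t : ℝ, ENNReal.ofReal (1 / (1 + t ^ 2)) ∂μ := by
    intro y hy
    unfold poissonIntegral
    rw [← lintegral_const_mul _ (by fun_prop)]
    refine (setLIntegral_mono (by fun_prop) fun t ht => ?_).trans (setLIntegral_le_lintegral _ _)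
    rw [← ENNReal.ofReal_mul (by positivity)]
    apply ENNReal.ofReal_le_ofReal
    have ht' : δ < |t - x| := by
      simpa [Real.dist_eq] using ht
    have hsq : δ ^ 2 < (t - x) ^ 2 := by
      rw [← sq_abs (t - x)]
      gcongr
    have hpos : 0 < (t - x) ^ 2 := by nlinarith [sq_nonneg δ]
    have h1 : 1 + t ^ 2 ≤ c * (t - x) ^ 2 := by
      have h2 : 1 + 2 * x ^ 2 ≤ (1 + 2 * x ^ 2) / δ ^ 2 * (t - x) ^ 2 := by
        rw [div_mul_eq_mul_div, le_div_iff₀ (by positivity)]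
        gcongr
      simp only [c]
      nlinarith [sq_nonneg (2 * x - t)]
    have h3 : 1 / ((t - x) ^ 2 + y ^ 2) ≤ c * (1 / (1 + t ^ 2)) := by
      rw [mul_one_div, div_le_div_iff₀ (by positivity) (by positivity)]
      nlinarith [mul_nonneg hc.le (sq_nonneg y)]
    calc halfPlaneKernel x y t = y / Real.pi * (1 / ((t - x) ^ 2 + y ^ 2)) := by
          unfold halfPlaneKernel; ring
      _ ≤ y / Real.pi * (c * (1 / (1 + t ^ 2))) := by gcongr
      _ = _ := by ring
  have hlim : Tendsto (fun y : ℝ => ENNReal.ofReal (y * c / Real.pi)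
      * ∫⁻ t : ℝ, ENNReal.ofReal (1 / (1 + t ^ 2)) ∂μ) (𝓝[>] 0) (𝓝 0) := by
    have h1 : Tendsto (fun y : ℝ => ENNReal.ofReal (y * c / Real.pi)) (𝓝[>] 0) (𝓝 0) := by
      have : Tendsto (fun y : ℝ => y * c / Real.pi) (𝓝[>] 0) (𝓝 (0 * c / Real.pi)) :=
        ((tendsto_id.mono_left nhdsWithin_le_nhds).mul_const c).div_const _
      simpa using ENNReal.tendsto_ofReal this
    simpa using ENNReal.Tendsto.mul_const h1 (Or.inr hμ.ne)
  refine tendsto_of_tendsto_of_tendsto_of_le_of_le' tendsto_const_nhds hlim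
    (Eventually.of_forall fun _ => zero_le) ?_
  filter_upwards [self_mem_nhdsWithin] with y hy using hb y hy

theorem lintegral_ofReal_inv_one_add_sq_lt_top :
    ∫⁻ t : ℝ, ENNReal.ofReal (1 / (1 + t ^ 2)) < ∞ := by
  have := integrable_inv_one_add_sq
  simp_rw [one_div]
  exact (hasFiniteIntegral_iff_ofReal (ae_of_all _ fun x => by positivity)).1 this.2

open Metric Filter Topology in
/-- The Poisson integral of `μ` converges vertically to the symmetric derivative of `μ`. -/
theorem tendsto_poissonIntegral_of_tendsto_div {μ : Measure ℝ}
    (hμ : ∫⁻ t : ℝ, ENNReal.ofReal (1 / (1 + t ^ 2)) ∂μ < ∞) {x : ℝ} {d : ℝ≥0∞}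
    (h : Tendsto (fun r => μ (closedBall x r) / volume (closedBall x r)) (𝓝[>] 0) (𝓝 d)) :
    Tendsto (fun y => poissonIntegral μ x y) (𝓝[>] 0) (𝓝 d) := by
  have hv0 : ∀ r : ℝ, 0 < r → volume (closedBall x r) ≠ 0 := fun r hr =>
    (measure_closedBall_pos volume x hr).ne'
  have hvt : ∀ r : ℝ, volume (closedBall x r) ≠ ∞ := fun r => measure_closedBall_lt_top.ne
  rw [tendsto_order]
  constructor
  · intro a ha
    obtain ⟨c, hac, hcd⟩ := exists_between ha
    have hev := (tendsto_order.1 h).1 c hcd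
    obtain ⟨δ, hδ, hball⟩ := mem_nhdsGT_iff_exists_Ioc_subset.1 hev
    have hδ : 0 < δ := hδ
    -- Balls larger than δ are cut to radius min R δ, where the density bound holds; the radius 0 is
    -- treated apart.
    have hle : ∀ y, 0 < y →
        c * poissonIntegral (volume.restrict (closedBall x δ)) x y ≤ poissonIntegral μ x y := by
      intro y hy
      rw [← poissonIntegral_smul]
      refine poissonIntegral_mono_of_closedBall hy fun R hR => ?_
      rw [Measure.smul_apply, Measure.restrict_apply measurableSet_closedBall, smul_eq_mul]
      rcases hR.eq_or_lt with rfl | hR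
      · have : volume (closedBall x 0 ∩ closedBall x δ) = 0 :=
          measure_mono_null Set.inter_subset_left (by simp)
        rw [this, mul_zero]
        exact zero_le
      · have hm : min R δ ∈ Set.Ioc 0 δ := ⟨lt_min hR hδ, min_le_right _ _⟩
        have h1 : c < μ (closedBall x (min R δ)) / volume (closedBall x (min R δ)) := hball hm
        have h2 := (ENNReal.lt_div_iff_mul_lt (Or.inl (hv0 _ hm.1)) (Or.inl (hvt _))).1 h1
        calc c * volume (closedBall x R ∩ closedBall x δ)
            ≤ c * volume (closedBall x (min R δ)) := by
              gcongr
              intro s hs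
              exact mem_closedBall.2 (le_min hs.1 hs.2)
          _ ≤ μ (closedBall x (min R δ)) := h2.le
          _ ≤ μ (closedBall x R) := measure_mono (closedBall_subset_closedBall (min_le_left _ _))
    have hnear : Tendsto (fun y => poissonIntegral (volume.restrict (closedBall x δ)) x y)
        (𝓝[>] 0) (𝓝 1) := by
      have hfar := tendsto_poissonIntegral_restrict_compl
        lintegral_ofReal_inv_one_add_sq_lt_top x hδ
      have h1 : Tendsto (fun y => 1 - poissonIntegral (volume.restrict (closedBall x δ)ᶜ) x y)
          (𝓝[>] 0) (𝓝 (1 - 0)) :=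
        ENNReal.Tendsto.sub tendsto_const_nhds hfar (Or.inl ENNReal.one_ne_top)
      rw [tsub_zero] at h1
      refine h1.congr' ?_
      filter_upwards [self_mem_nhdsWithin] with y hy
      have e := poissonIntegral_restrict_add_compl volume x y
        (measurableSet_closedBall (x := x) (ε := δ))
      rw [poissonIntegral_volume hy] at e
      refine (ENNReal.eq_sub_of_add_eq ?_ e).symm
      exact ne_top_of_le_ne_top ENNReal.one_ne_top (e ▸ le_add_self)
    have hlim : Tendsto (fun y => c * poissonIntegral (volume.restrict (closedBall x δ)) x y)
        (𝓝[>] 0) (𝓝 c) := by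
      simpa using ENNReal.Tendsto.const_mul hnear (Or.inl one_ne_zero)
    filter_upwards [(tendsto_order.1 hlim).1 a hac, self_mem_nhdsWithin] with y h1 hy
    exact h1.trans_le (hle y hy)
  · intro a ha
    obtain ⟨c, hdc, hca⟩ := exists_between ha
    have hct : c ≠ ∞ := hca.ne_top
    have hev := (tendsto_order.1 h).2 c hdc
    obtain ⟨δ, hδ, hball⟩ := mem_nhdsGT_iff_exists_Ioc_subset.1 hev
    have hδ : 0 < δ := hδ
    have hup : ∀ R ∈ Set.Ioc 0 δ, μ (closedBall x R) ≤ c * volume (closedBall x R) := by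
      intro R hR
      have h1 : μ (closedBall x R) / volume (closedBall x R) < c := hball hR
      exact (ENNReal.div_le_iff (hv0 _ hR.1) (hvt _)).1 h1.le
    -- The bound on small balls excludes an atom at x, which settles the radius 0.
    have hzero : μ (closedBall x 0) = 0 := by
      have h1 : Tendsto (fun R : ℝ => c * volume (closedBall x R)) (𝓝[>] 0) (𝓝 0) := by
        have h2 : Tendsto (fun R : ℝ => ENNReal.ofReal (2 * R)) (𝓝[>] 0) (𝓝 0) := by
          have : Tendsto (fun R : ℝ => 2 * R) (𝓝[>] 0) (𝓝 (2 * 0)) :=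
            (tendsto_id.mono_left nhdsWithin_le_nhds).const_mul 2
          simpa using ENNReal.tendsto_ofReal this
        simpa using ENNReal.Tendsto.const_mul h2 (Or.inr hct)
      refine le_antisymm (ge_of_tendsto h1 ?_) (zero_le)
      filter_upwards [Ioc_mem_nhdsGT hδ] with R hR
      exact (measure_mono (closedBall_subset_closedBall hR.1.le)).trans (hup R hR)
    have hle : ∀ y, 0 < y → poissonIntegral μ x y
        ≤ c + poissonIntegral (μ.restrict (closedBall x δ)ᶜ) x y := by
      intro y hy
      rw [← poissonIntegral_restrict_add_compl μ x y
        (measurableSet_closedBall (x := x) (ε := δ))]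
      gcongr
      rw [← mul_one c, ← poissonIntegral_volume hy x, ← poissonIntegral_smul]
      refine poissonIntegral_mono_of_closedBall hy fun R hR => ?_
      rw [Measure.smul_apply, Measure.restrict_apply measurableSet_closedBall, smul_eq_mul]
      rcases hR.eq_or_lt with rfl | hR
      · rw [measure_mono_null Set.inter_subset_left hzero]
        exact zero_le
      · have hm : min R δ ∈ Set.Ioc 0 δ := ⟨lt_min hR hδ, min_le_right _ _⟩
        calc μ (closedBall x R ∩ closedBall x δ)
            ≤ μ (closedBall x (min R δ)) := by
              apply measure_mono
              intro s hs
              exact mem_closedBall.2 (le_min hs.1 hs.2)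
          _ ≤ c * volume (closedBall x (min R δ)) := hup _ hm
          _ ≤ c * volume (closedBall x R) := by
              gcongr
              exact min_le_left _ _
    have hlim : Tendsto (fun y => c + poissonIntegral (μ.restrict (closedBall x δ)ᶜ) x y)
        (𝓝[>] 0) (𝓝 c) := by
      simpa using (tendsto_poissonIntegral_restrict_compl hμ x hδ).const_add c
    filter_upwards [(tendsto_order.1 hlim).2 a hca, self_mem_nhdsWithin] with y h1 hy
    exact (hle y hy).trans_lt h1

open Filter Topology in
/-- **Fatou's theorem**: the Poisson integral of `μ` converges vertically, almost everywhere, to the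
density of the absolutely continuous part of `μ`. -/
theorem ae_tendsto_poissonIntegral {μ : Measure ℝ} [IsLocallyFiniteMeasure μ]
    (hμ : ∫⁻ t : ℝ, ENNReal.ofReal (1 / (1 + t ^ 2)) ∂μ < ∞) :
    ∀ᵐ x : ℝ, μ.rnDeriv volume x < ∞ ∧
      Tendsto (fun y => poissonIntegral μ x y) (𝓝[>] 0) (𝓝 (μ.rnDeriv volume x)) := by
  filter_upwards [Besicovitch.ae_tendsto_rnDeriv μ volume, μ.rnDeriv_lt_top volume] with x hx hlt
  exact ⟨hlt, tendsto_poissonIntegral_of_tendsto_div hμ hx⟩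

/-! ### Harmonic measure near the boundary -/

theorem hasDerivAt_arctan_div_pi {v : ℝ} (hv : 0 < v) (u t : ℝ) :
    HasDerivAt (fun t => Real.arctan ((t - u) / v) / Real.pi) (halfPlaneKernel u v t) t := by
  have h := (((hasDerivAt_id t).sub_const u).div_const v).arctan.div_const Real.pi
  refine h.congr_deriv ?_
  unfold halfPlaneKernel
  have : 0 < 1 + ((id t - u) / v) ^ 2 := by positivity
  simp only [id] at this ⊢
  field_simp
  ring

open Filter Topology in
/-- The harmonic measure of a half-line. -/
theorem poissonIntegral_restrict_Iic {v : ℝ} (hv : 0 < v) (u a : ℝ) :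
    poissonIntegral (volume.restrict (Set.Iic a)) u v
      = ENNReal.ofReal (1 / 2 + Real.arctan ((a - u) / v) / Real.pi) := by
  unfold poissonIntegral
  have hi := (integrable_halfPlaneKernel hv u).integrableOn (s := Set.Iic a)
  rw [← ofReal_integral_eq_lintegral_ofReal hi
    (ae_of_all _ (halfPlaneKernel_nonneg hv.le u))]
  have hlim : Tendsto (fun t => Real.arctan ((t - u) / v) / Real.pi) atBot
      (𝓝 (-(Real.pi / 2) / Real.pi)) := by
    refine Tendsto.div_const ((Real.tendsto_arctan_atBot.mono_right nhdsWithin_le_nhds).comp ?_) _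
    exact (tendsto_atBot_add_const_right _ (-u) tendsto_id).atBot_div_const hv
  rw [integral_Iic_of_hasDerivAt_of_tendsto' (fun t _ => hasDerivAt_arctan_div_pi hv u t) hi hlim]
  congr 1
  have := Real.pi_pos
  field_simp
  ring

/-- The harmonic measure of a compact interval. -/
theorem poissonIntegral_restrict_Icc {v : ℝ} (hv : 0 < v) (u : ℝ) {a b : ℝ} (hab : a ≤ b) :
    poissonIntegral (volume.restrict (Set.Icc a b)) u v
      = ENNReal.ofReal ((Real.arctan ((b - u) / v) - Real.arctan ((a - u) / v)) / Real.pi) := by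
  unfold poissonIntegral
  have hi := (integrable_halfPlaneKernel hv u).integrableOn (s := Set.Icc a b)
  rw [← ofReal_integral_eq_lintegral_ofReal hi
    (ae_of_all _ (halfPlaneKernel_nonneg hv.le u)), integral_Icc_eq_integral_Ioc,
    ← intervalIntegral.integral_of_le hab,
    intervalIntegral.integral_eq_sub_of_hasDerivAt
      (fun t _ => hasDerivAt_arctan_div_pi hv u t)
      ((continuous_halfPlaneKernel hv u).intervalIntegrable _ _), ← sub_div]

open Filter Topology in
theorem tendsto_atTop_of_tendsto_arctan {X : ℕ → ℝ}
    (h : Tendsto (fun n => Real.arctan (X n)) atTop (𝓝 (Real.pi / 2))) :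
    Tendsto X atTop atTop := by
  refine tendsto_atTop.2 fun M => ?_
  filter_upwards [(tendsto_order.1 h).1 _ (Real.arctan_lt_pi_div_two M)] with n hn
  exact (Real.arctan_strictMono.lt_iff_lt.1 hn).le

-- Here a - u is eventually positive, and the cross term in (r - u)² = ((a - u) + (r - a))² bounds
-- the kernel by v / ((a - u)(r - a)) / π.
open Filter Topology in
theorem tendsto_halfPlaneKernel_zero_of_arctan {u v : ℕ → ℝ} (hv : ∀ n, 0 < v n) {a r : ℝ}
    (har : a < r)
    (h : Tendsto (fun n => Real.arctan ((a - u n) / v n)) atTop (𝓝 (Real.pi / 2))) :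
    Tendsto (fun n => halfPlaneKernel (u n) (v n) r) atTop (𝓝 0) := by
  have hX := tendsto_atTop_of_tendsto_arctan h
  have hlim : Tendsto (fun n => ((a - u n) / v n)⁻¹ * ((r - a)⁻¹ / Real.pi)) atTop (𝓝 0) := by
    simpa using hX.inv_tendsto_atTop.mul_const ((r - a)⁻¹ / Real.pi)
  refine tendsto_of_tendsto_of_tendsto_of_le_of_le' tendsto_const_nhds hlim
    (Eventually.of_forall fun n => halfPlaneKernel_nonneg (hv n).le _ _) ?_
  filter_upwards [hX.eventually_gt_atTop 0] with n hn
  have hp : 0 < a - u n := by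
    have := mul_pos hn (hv n)
    rwa [div_mul_cancel₀ _ (hv n).ne'] at this
  have hq : 0 < r - a := sub_pos.2 har
  have h1 : (a - u n) * (r - a) ≤ (r - u n) ^ 2 + v n ^ 2 := by
    nlinarith [sq_nonneg (v n), sq_nonneg (a - u n), sq_nonneg (r - a), mul_pos hp hq]
  have h2 : v n / ((r - u n) ^ 2 + v n ^ 2) ≤ v n / ((a - u n) * (r - a)) :=
    div_le_div_of_nonneg_left (hv n).le (mul_pos hp hq) h1
  calc halfPlaneKernel (u n) (v n) r ≤ v n / ((a - u n) * (r - a)) / Real.pi := by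
        unfold halfPlaneKernel
        exact div_le_div_of_nonneg_right h2 Real.pi_pos.le
    _ = _ := by rw [inv_div]; field_simp

open Filter Topology in
/-- Boundary behaviour of the harmonic measure of `[0, 1]` along a sequence `u n + i v n` for which
the harmonic measures of rational half-lines converge and the Poisson kernels at rational points
have finite limits. -/
theorem lintegral_liminf_halfPlaneKernel {u v : ℕ → ℝ} (hv : ∀ n, 0 < v n)
    (hc : ∀ a : ℚ, ∃ c, Tendsto (fun n => Real.arctan ((a - u n) / v n)) atTop (𝓝 c))
    (hk : ∀ a : ℚ, ∃ κ, Tendsto (fun n => halfPlaneKernel (u n) (v n) a) atTop (𝓝 κ))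
    {ρ A : ℝ≥0∞}
    (hρ : Tendsto (fun n => poissonIntegral (volume.restrict (Set.Icc 0 1)) (u n) (v n)) atTop
      (𝓝 ρ))
    (hA : A = ∫⁻ r in Set.Icc (0 : ℝ) 1,
      liminf (fun n => ENNReal.ofReal (halfPlaneKernel (u n) (v n) r)) atTop) :
    A = ρ ∨ (A = 0 ∧ (ρ = 0 ∨ ρ = 1)) := by
  have hpi := Real.pi_pos
  choose c hc using hc
  have hρ' : ρ = ENNReal.ofReal ((c 1 - c 0) / Real.pi) := by
    refine tendsto_nhds_unique hρ ?_
    simp_rw [fun n => poissonIntegral_restrict_Icc (hv n) (u n) zero_le_one]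
    refine ENNReal.tendsto_ofReal (Tendsto.div_const ?_ _)
    simpa using (hc 1).sub (hc 0)
  have hA0 : (∀ᵐ r : ℝ, Tendsto (fun n => halfPlaneKernel (u n) (v n) r) atTop (𝓝 0)) →
      A = 0 := by
    intro h0
    rw [hA, lintegral_congr_ae (ae_restrict_of_ae (h0.mono fun r hr => ?_)), lintegral_zero]
    simpa using (ENNReal.tendsto_ofReal hr).liminf_eq
  by_cases hex : ∃ a, c a ≠ Real.pi / 2 ∧ c a ≠ -(Real.pi / 2)
  · obtain ⟨a, ha1, ha2⟩ := hex
    have hle : c a ≤ Real.pi / 2 :=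
      le_of_tendsto (hc a) (Eventually.of_forall fun n => (Real.arctan_lt_pi_div_two _).le)
    have hge : -(Real.pi / 2) ≤ c a :=
      ge_of_tendsto (hc a) (Eventually.of_forall fun n => (Real.neg_pi_div_two_lt_arctan _).le)
    have hcos : Real.cos (c a) ≠ 0 :=
      (Real.cos_pos_of_mem_Ioo ⟨lt_of_le_of_ne hge ha2.symm, lt_of_le_of_ne hle ha1⟩).ne'
    let X : ℕ → ℝ := fun n => (a - u n) / v n
    have hX : Tendsto X atTop (𝓝 (Real.tan (c a))) := by
      have := (Real.continuousAt_tan.2 hcos).tendsto.comp (hc a)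
      simpa [Function.comp_def, Real.tan_arctan] using this
    obtain ⟨κ, hκ⟩ := hk a
    -- 1 / v is the kernel at a times π(1 + X²). Its finite limit shows that v cannot tend to 0
    -- while some rational is seen under a nondegenerate angle.
    have hs : Tendsto (fun n => 1 / v n) atTop
        (𝓝 (κ * Real.pi * (1 + Real.tan (c a) ^ 2))) := by
      refine ((hκ.mul_const Real.pi).mul ((hX.pow 2).const_add 1)).congr fun n => ?_
      have := hv n
      have h1 : (a - u n) ^ 2 + v n ^ 2 ≠ 0 := by positivity
      simp only [X, halfPlaneKernel]
      field_simp
      ring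
    set s := κ * Real.pi * (1 + Real.tan (c a) ^ 2) with hsdef
    have hs0 : 0 ≤ s := ge_of_tendsto hs (Eventually.of_forall fun n => by
      have := hv n
      positivity)
    -- If s = 0, then v tends to infinity and all rationals get the same angle; if s > 0, then u + i
    -- v converges inside the half-plane.
    rcases hs0.eq_or_lt with hs0 | hs0
    · rw [← hs0] at hs
      right
      refine ⟨hA0 (ae_of_all _ fun r => ?_), Or.inl ?_⟩
      · have hlim : Tendsto (fun n => 1 / v n / Real.pi) atTop (𝓝 0) := by
          simpa using hs.div_const Real.pi
        refine tendsto_of_tendsto_of_tendsto_of_le_of_le tendsto_const_nhds hlim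
          (fun n => halfPlaneKernel_nonneg (hv n).le _ _) (fun n => ?_)
        have := hv n
        simp only [halfPlaneKernel]
        refine div_le_div_of_nonneg_right ?_ hpi.le
        rw [div_le_div_iff₀ (by positivity) this]
        nlinarith [sq_nonneg (r - u n)]
      · have hb : ∀ b, c b = c a := by
          intro b
          refine tendsto_nhds_unique (hc b) ?_
          have h1 : Tendsto (fun n => X n + (b - a) * (1 / v n)) atTop
              (𝓝 (Real.tan (c a) + (b - a) * 0)) := hX.add (hs.const_mul _)
          have h2 := (Real.continuous_arctan.tendsto _).comp h1
          rw [mul_zero, add_zero, Real.arctan_tan (lt_of_le_of_ne hge ha2.symm)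
            (lt_of_le_of_ne hle ha1)] at h2
          refine h2.congr fun n => ?_
          simp only [Function.comp_apply, X]
          congr 1
          ring
        rw [hρ', hb 1, hb 0]
        simp
    · left
      have hV : Tendsto v atTop (𝓝 s⁻¹) := by
        simpa using hs.inv₀ hs0.ne'
      have hU : Tendsto u atTop (𝓝 (a - s⁻¹ * Real.tan (c a))) := by
        refine ((hV.mul hX).const_sub (a : ℝ)).congr fun n => ?_
        have := hv n
        simp only [X]
        field_simp
        ring
      set V := s⁻¹
      set W := a - V * Real.tan (c a)
      have hVpos : 0 < V := inv_pos.2 hs0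
      have hlim : ∀ r : ℝ, Tendsto (fun n => halfPlaneKernel (u n) (v n) r) atTop
          (𝓝 (halfPlaneKernel W V r)) := by
        intro r
        have hne : (r - W) ^ 2 + V ^ 2 ≠ 0 := by positivity
        exact (hV.div (((hU.const_sub r).pow 2).add (hV.pow 2)) hne).div_const _
      have harc : ∀ b : ℝ, Tendsto (fun n => Real.arctan ((b - u n) / v n)) atTop
          (𝓝 (Real.arctan ((b - W) / V))) := fun b =>
        (Real.continuous_arctan.tendsto _).comp ((hU.const_sub b).div hV hVpos.ne')
      have e1 : A = poissonIntegral (volume.restrict (Set.Icc 0 1)) W V := by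
        rw [hA, poissonIntegral]
        congr 1
        ext r
        exact (ENNReal.tendsto_ofReal (hlim r)).liminf_eq
      rw [e1]
      refine tendsto_nhds_unique ?_ hρ
      simp_rw [fun n => poissonIntegral_restrict_Icc (hv n) (u n) zero_le_one,
        poissonIntegral_restrict_Icc hVpos W zero_le_one]
      exact ENNReal.tendsto_ofReal (((harc 1).sub (harc 0)).div_const _)
  -- All limit angles are ±π/2: in the limit each rational half-line has harmonic measure 0 or 1.
  · push Not at hex
    have hdich : ∀ a, c a = Real.pi / 2 ∨ c a = -(Real.pi / 2) := fun a => by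
      by_cases h : c a = Real.pi / 2
      · exact Or.inl h
      · exact Or.inr (hex a h)
    right
    constructor
    · apply hA0
      -- The possible points where the angle jumps from -π/2 to π/2. There is at most one, and
      -- elsewhere the kernel tends to 0.
      let B : Set ℝ := {r | (∀ a : ℚ, (a : ℝ) < r → c a ≠ Real.pi / 2) ∧
        ∀ a : ℚ, r < a → c a ≠ -(Real.pi / 2)}
      have hB : B.Subsingleton := by
        have key : ∀ r ∈ B, ∀ r' ∈ B, ¬ r < r' := by
          intro r hr r' hr' hlt
          obtain ⟨a, h1, h2⟩ := exists_rat_btwn hlt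
          rcases hdich a with h | h
          · exact hr'.1 a h2 h
          · exact hr.2 a h1 h
        intro r hr r' hr'
        exact le_antisymm (not_lt.1 (key r' hr' r hr)) (not_lt.1 (key r hr r' hr'))
      have hB0 : volume B = 0 := hB.measure_zero volume
      filter_upwards [measure_eq_zero_iff_ae_notMem.1 hB0] with r hr
      by_cases h1 : ∀ a : ℚ, (a : ℝ) < r → c a ≠ Real.pi / 2
      · have h2 : ¬ ∀ a : ℚ, r < a → c a ≠ -(Real.pi / 2) := fun h2 => hr ⟨h1, h2⟩
        push Not at h2
        obtain ⟨a, har, hca⟩ := h2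
        -- Reflection about 0 reduces the angle -π/2 to the angle π/2.
        have h3 : Tendsto (fun n => Real.arctan ((-(a : ℝ) - -u n) / v n)) atTop
            (𝓝 (Real.pi / 2)) := by
          have := (hc a).neg
          rw [hca, neg_neg] at this
          refine this.congr fun n => ?_
          rw [← Real.arctan_neg]
          congr 1
          ring
        have h4 := tendsto_halfPlaneKernel_zero_of_arctan (u := fun n => -u n) hv
          (neg_lt_neg har) h3
        refine h4.congr fun n => ?_
        simp only [halfPlaneKernel]
        congr 3
        ring
      · push Not at h1
        obtain ⟨a, har, hca⟩ := h1
        exact tendsto_halfPlaneKernel_zero_of_arctan hv har (hca ▸ hc a)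
    · rw [hρ']
      rcases hdich 0 with h0 | h0 <;> rcases hdich 1 with h1 | h1 <;> rw [h0, h1]
      · simp
      · left
        apply ENNReal.ofReal_of_nonpos
        apply div_nonpos_of_nonpos_of_nonneg _ hpi.le
        linarith
      · right
        rw [sub_neg_eq_add, add_halves, div_self hpi.ne', ENNReal.ofReal_one]
      · simp

/-! ### Spectral averaging -/

-- On this ball the kernel is at least 1 / (2πy).
open Metric in
theorem measure_closedBall_le_poissonIntegral (η : Measure ℝ) (x : ℝ) {y : ℝ} (hy : 0 < y) :
    η (closedBall x y) ≤ ENNReal.ofReal (2 * Real.pi * y) * poissonIntegral η x y := by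
  have hpi := Real.pi_pos
  unfold poissonIntegral
  rw [← lintegral_const_mul' _ _ (by simp), ← lintegral_indicator_one measurableSet_closedBall]
  refine lintegral_mono fun t => ?_
  by_cases ht : t ∈ closedBall x y
  · rw [Set.indicator_of_mem ht, Pi.one_apply, ← ENNReal.ofReal_mul (by positivity),
      ENNReal.one_le_ofReal]
    rw [mem_closedBall, Real.dist_eq] at ht
    have h1 : (t - x) ^ 2 ≤ y ^ 2 := by
      rw [← sq_abs (t - x)]
      gcongr
    have e : 2 * Real.pi * y * halfPlaneKernel x y t = 2 * y ^ 2 / ((t - x) ^ 2 + y ^ 2) := by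
      unfold halfPlaneKernel
      field_simp
    rw [e, one_le_div (by positivity)]
    linarith
  · rw [Set.indicator_of_notMem ht]
    exact zero_le

open Metric Filter Topology in
/-- A measure with Poisson integral bounded by `1` is bounded by `π` times Lebesgue measure. -/
theorem le_smul_volume_of_poissonIntegral_le_one {η : Measure ℝ}
    (h : ∀ x y : ℝ, 0 < y → poissonIntegral η x y ≤ 1) :
    η ≤ Real.pi.toNNReal • (volume : Measure ℝ) := by
  have hb : ∀ x y : ℝ, 0 < y →
      η (closedBall x y) ≤ (Real.pi.toNNReal • (volume : Measure ℝ)) (closedBall x y) := by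
    intro x y hy
    refine (measure_closedBall_le_poissonIntegral η x hy).trans ?_
    refine (mul_le_mul_right (h x y hy) _).trans ?_
    rw [mul_one, Measure.smul_apply, Real.volume_closedBall, ENNReal.smul_def, smul_eq_mul]
    change _ ≤ ENNReal.ofReal Real.pi * _
    rw [← ENNReal.ofReal_mul Real.pi_pos.le]
    apply ENNReal.ofReal_le_ofReal
    linarith
  have hlf : IsLocallyFiniteMeasure η :=
    ⟨fun x => ⟨closedBall x 1, closedBall_mem_nhds x one_pos,
      (hb x 1 one_pos).trans_lt measure_closedBall_lt_top⟩⟩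
  refine Measure.le_iff'.2 fun s => ?_
  refine (Besicovitch.vitaliFamily η).measure_le_of_frequently_le _
    Measure.AbsolutelyContinuous.rfl s fun x _ => ?_
  -- The Besicovitch covering theorem passes from balls to all sets. The constant π is crude, but
  -- only absolute continuity, local finiteness and weighted integrability are drawn from it.
  refine (Besicovitch.tendsto_filterAt η x).frequently (Eventually.frequently ?_)
  filter_upwards [self_mem_nhdsWithin] with y hy using hb x y hy

theorem IsHerglotz.continuous_line {h : ℂ → ℂ} (hh : IsHerglotz h) {y : ℝ} (hy : 0 < y) :
    Continuous fun x : ℝ => h (x + y * Complex.I) :=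
  hh.differentiableOn.continuousOn.comp_continuous (by fun_prop) fun x => by simpa

section Average

variable {h : ℂ → ℂ} {μ : ℝ → Measure ℝ}

/-- The identity behind spectral averaging: the parameter r becomes the boundary variable of a
Poisson kernel based at h(z). -/
theorem herglotzShift_im_div_pi (h : ℂ → ℂ) (r : ℝ) (z : ℂ) :
    (herglotzShift h r z).im / Real.pi = halfPlaneKernel (h z).re (h z).im r := by
  rw [herglotzShift_im, halfPlaneKernel]

theorem IsHerglotzMeasure.isLocallyFiniteMeasure {f : ℂ → ℂ} {ν : Measure ℝ}
    (hν : IsHerglotzMeasure f ν) : IsLocallyFiniteMeasure ν := by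
  obtain ⟨α, β, hT⟩ := hν
  exact hT.isLocallyFiniteMeasure

/-- The family of measures `μ_r` is measurable. -/
theorem IsHerglotz.measurable_herglotzMeasure (hh : IsHerglotz h)
    (hμ : ∀ r, IsHerglotzMeasure (herglotzShift h r) (μ r)) : Measurable μ := by
  choose α β hT using hμ
  refine measurable_measure_of_integral (fun r => (hT r).isLocallyFiniteMeasure)
    fun φ hφ hc => ?_
  refine measurable_of_tendsto_metrizable (fun n => ?_) (tendsto_pi_nhds.2 fun r =>
    (hT r).tendsto_integral hφ hc one_div_nat_succ_pos
      one_div_nat_succ_le_one tendsto_one_div_nat_succ)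
  have hl : Measurable fun p : ℝ × ℝ => h (p.2 + (1 / ((n : ℝ) + 1) : ℝ) * Complex.I) :=
    (hh.continuous_line (one_div_nat_succ_pos n)).measurable.comp measurable_snd
  have hm : Measurable fun p : ℝ × ℝ => φ p.2 *
      ((herglotzShift h p.1 (p.2 + (1 / ((n : ℝ) + 1) : ℝ) * Complex.I)).im / Real.pi) := by
    simp_rw [herglotzShift_im_div_pi]
    exact (hφ.measurable.comp measurable_snd).mul
      (Measurable.halfPlaneKernel (Complex.measurable_re.comp hl) (Complex.measurable_im.comp hl)
        measurable_fst)
  exact hm.stronglyMeasurable.integral_prod_right.measurable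

/-- **Spectral averaging**: the Poisson integral of the average of the measures `μ_r` over `J` is
the harmonic measure of `J` composed with `h`, up to a linear term. -/
theorem IsHerglotz.exists_poissonIntegral_bind (hh : IsHerglotz h)
    (hμ : ∀ r, IsHerglotzMeasure (herglotzShift h r) (μ r)) (J : Set ℝ) :
    ∃ C : ℝ≥0∞, C ≠ ∞ ∧ ∀ x y : ℝ, 0 < y →
      poissonIntegral (volume.restrict J) (h (x + y * Complex.I)).re (h (x + y * Complex.I)).im
        = C * ENNReal.ofReal y + poissonIntegral ((volume.restrict J).bind μ) x y := by
  have hmeas := hh.measurable_herglotzMeasure hμ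
  choose α β hT using hμ
  have key : ∀ x y : ℝ, 0 < y →
      poissonIntegral (volume.restrict J) (h (x + y * Complex.I)).re (h (x + y * Complex.I)).im
        = (∫⁻ r in J, ENNReal.ofReal (α r / Real.pi)) * ENNReal.ofReal y
          + poissonIntegral ((volume.restrict J).bind μ) x y := by
    intro x y hy
    have hk : Measurable fun t => ENNReal.ofReal (halfPlaneKernel x y t) :=
      (continuous_halfPlaneKernel hy x).measurable.ennreal_ofReal
    have hpm : Measurable fun r => poissonIntegral (μ r) x y :=
      (Measure.measurable_lintegral hk).comp hmeas
    have e : poissonIntegral ((volume.restrict J).bind μ) x y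
        = ∫⁻ r in J, poissonIntegral (μ r) x y :=
      Measure.lintegral_bind hmeas.aemeasurable hk.aemeasurable
    -- These forms require no measurability of `α`, which is merely chosen.
    rw [e, ← lintegral_mul_const' _ _ ENNReal.ofReal_ne_top, ← lintegral_add_right _ hpm]
    refine lintegral_congr fun r => ?_
    rw [← (hT r).ofReal_im_eq hy x, herglotzShift_im_div_pi]
  refine ⟨_, ?_, key⟩
  -- At z = i the linear coefficient is at most a harmonic measure, hence at most 1.
  have h1 := key 0 1 one_pos
  have him : 0 < (h ((0 : ℝ) + (1 : ℝ) * Complex.I)).im := hh.mapsTo (by simp)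
  rw [ENNReal.ofReal_one, mul_one] at h1
  refine ne_top_of_le_ne_top ENNReal.one_ne_top (le_self_add.trans (h1.symm.le.trans ?_))
  rw [← poissonIntegral_volume him (h ((0 : ℝ) + (1 : ℝ) * Complex.I)).re]
  exact lintegral_mono' Measure.restrict_le_self le_rfl

theorem IsHerglotz.bind_le_smul_volume (hh : IsHerglotz h)
    (hμ : ∀ r, IsHerglotzMeasure (herglotzShift h r) (μ r)) (J : Set ℝ) :
    (volume.restrict J).bind μ ≤ Real.pi.toNNReal • (volume : Measure ℝ) := by
  obtain ⟨C, -, hC⟩ := hh.exists_poissonIntegral_bind hμ J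
  refine le_smul_volume_of_poissonIntegral_le_one fun x y hy => ?_
  have him : 0 < (h (x + y * Complex.I)).im := hh.mapsTo (by simpa)
  refine (le_add_self.trans (hC x y hy).symm.le).trans ?_
  rw [← poissonIntegral_volume him (h (x + y * Complex.I)).re]
  exact lintegral_mono' Measure.restrict_le_self le_rfl

/-! ### Boundary values along h and measurability of the singular parts -/

open Filter Topology in
theorem tendsto_one_div_nat_succ_nhdsGT :
    Tendsto (fun n : ℕ => 1 / ((n : ℝ) + 1)) atTop (𝓝[>] 0) :=
  tendsto_nhdsWithin_iff.2 ⟨tendsto_one_div_nat_succ,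
    Eventually.of_forall fun n => one_div_nat_succ_pos n⟩

open Filter Topology in
theorem tendsto_ofReal_one_div_nat_succ (C : ℝ≥0∞) (hC : C ≠ ∞) :
    Tendsto (fun n : ℕ => C * ENNReal.ofReal (1 / ((n : ℝ) + 1))) atTop (𝓝 0) := by
  have := ENNReal.tendsto_ofReal tendsto_one_div_nat_succ
  simpa using ENNReal.Tendsto.const_mul this (Or.inr hC)

/-- The points `h (x + i / (n + 1))`. -/
noncomputable def verticalSeq (h : ℂ → ℂ) (n : ℕ) (x : ℝ) : ℂ :=
  h (x + (1 / ((n : ℝ) + 1) : ℝ) * Complex.I)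

theorem IsHerglotz.verticalSeq_im_pos (hh : IsHerglotz h) (n : ℕ) (x : ℝ) :
    0 < (verticalSeq h n x).im :=
  by
  have hy := one_div_nat_succ_pos n
  refine hh.mapsTo ?_
  rw [Set.mem_ofPred_eq, Complex.add_im, Complex.ofReal_im, zero_add, Complex.im_ofReal_mul,
    Complex.I_im, mul_one]
  exact hy

theorem IsHerglotz.continuous_verticalSeq (hh : IsHerglotz h) (n : ℕ) :
    Continuous (verticalSeq h n) :=
  hh.continuous_line (one_div_nat_succ_pos n)

-- Fatou's theorem for the averaged measure; the linear term of spectral averaging vanishes as y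
-- tends to 0.
open Filter Topology in
theorem IsHerglotz.ae_tendsto_poissonIntegral_bind (hh : IsHerglotz h)
    (hμ : ∀ r, IsHerglotzMeasure (herglotzShift h r) (μ r)) (J : Set ℝ) :
    ∀ᵐ x : ℝ, ((volume.restrict J).bind μ).rnDeriv volume x < ∞ ∧
      Tendsto (fun n => poissonIntegral (volume.restrict J) (verticalSeq h n x).re
        (verticalSeq h n x).im) atTop (𝓝 (((volume.restrict J).bind μ).rnDeriv volume x)) := by
  have hle := hh.bind_le_smul_volume hμ J
  obtain ⟨C, hCt, hC⟩ := hh.exists_poissonIntegral_bind hμ J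
  set η := (volume.restrict J).bind μ
  have : IsLocallyFiniteMeasure η := Measure.isLocallyFiniteMeasure_of_le hle
  have hfin : ∫⁻ t : ℝ, ENNReal.ofReal (1 / (1 + t ^ 2)) ∂η < ∞ := by
    refine (lintegral_mono' hle le_rfl).trans_lt ?_
    rw [lintegral_smul_measure]
    exact ENNReal.mul_lt_top ENNReal.coe_lt_top lintegral_ofReal_inv_one_add_sq_lt_top
  filter_upwards [ae_tendsto_poissonIntegral hfin] with x hx
  refine ⟨hx.1, ?_⟩
  have h1 := (tendsto_ofReal_one_div_nat_succ C hCt).add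
    (hx.2.comp tendsto_one_div_nat_succ_nhdsGT)
  rw [zero_add] at h1
  exact h1.congr fun n => (hC x _ (one_div_nat_succ_pos n)).symm

open Filter Topology in
theorem IsHerglotz.ae_tendsto_halfPlaneKernel {ν : Measure ℝ} (r : ℝ)
    (hν : IsHerglotzMeasure (herglotzShift h r) ν) :
    ∀ᵐ x : ℝ, ν.rnDeriv volume x < ∞ ∧
      Tendsto (fun n => ENNReal.ofReal (halfPlaneKernel (verticalSeq h n x).re
        (verticalSeq h n x).im r)) atTop (𝓝 (ν.rnDeriv volume x)) := by
  obtain ⟨α, β, hT⟩ := hν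
  have := hT.isLocallyFiniteMeasure
  filter_upwards [ae_tendsto_poissonIntegral hT.lintegral_lt_top] with x hx
  refine ⟨hx.1, ?_⟩
  have h1 := (tendsto_ofReal_one_div_nat_succ (ENNReal.ofReal (α / Real.pi))
    ENNReal.ofReal_ne_top).add (hx.2.comp tendsto_one_div_nat_succ_nhdsGT)
  rw [zero_add] at h1
  refine h1.congr fun n => ?_
  rw [verticalSeq, ← herglotzShift_im_div_pi, hT.ofReal_im_eq (one_div_nat_succ_pos n)]
  rfl

open Filter in
/-- The vertical boundary values of the Poisson kernels, which are the densities of the absolutely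
continuous parts of the measures `μ_r`. -/
noncomputable def boundaryDensity (h : ℂ → ℂ) (r x : ℝ) : ℝ≥0∞ :=
  liminf (fun n => ENNReal.ofReal (halfPlaneKernel (verticalSeq h n x).re
    (verticalSeq h n x).im r)) atTop

theorem IsHerglotz.measurable_boundaryDensity (hh : IsHerglotz h) :
    Measurable fun p : ℝ × ℝ => boundaryDensity h p.1 p.2 := by
  refine Measurable.liminf fun n => ?_
  have hl : Measurable fun p : ℝ × ℝ => verticalSeq h n p.2 :=
    (hh.continuous_verticalSeq n).measurable.comp measurable_snd
  exact (Measurable.halfPlaneKernel (Complex.measurable_re.comp hl)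
    (Complex.measurable_im.comp hl) measurable_fst).ennreal_ofReal

/-- By Fatou's theorem `boundaryDensity` is a version of the Radon–Nikodym derivative, chosen
because it is jointly measurable in r and x. -/
theorem singularPart_add_withDensity_boundaryDensity {ν : Measure ℝ} {r : ℝ}
    (hν : IsHerglotzMeasure (herglotzShift h r) ν) :
    ν.singularPart volume + volume.withDensity (boundaryDensity h r) = ν := by
  have := hν.isLocallyFiniteMeasure
  conv_rhs => rw [← ν.singularPart_add_rnDeriv volume]
  congr 1
  refine withDensity_congr_ae ?_
  filter_upwards [IsHerglotz.ae_tendsto_halfPlaneKernel r hν] with x hx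
  exact hx.2.liminf_eq

theorem IsHerglotz.measurable_withDensity_boundaryDensity (hh : IsHerglotz h) :
    Measurable fun r => volume.withDensity (boundaryDensity h r) := by
  refine Measure.measurable_of_measurable_coe _ fun s hs => ?_
  simp_rw [withDensity_apply _ hs]
  exact hh.measurable_boundaryDensity.lintegral_prod_right'

/-- The singular parts of the measures `μ_r` form a measurable family. -/
theorem IsHerglotz.measurable_singularPart (hh : IsHerglotz h)
    (hμ : ∀ r, IsHerglotzMeasure (herglotzShift h r) (μ r)) :
    Measurable fun r => (μ r).singularPart volume := by
  have hm := hh.measurable_herglotzMeasure hμ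
  have hd := hh.measurable_withDensity_boundaryDensity
  refine Measure.measurable_of_measurable_coe _ fun s hs => ?_
  simp_rw [measure_eq_iSup_inter_Ioo _ s]
  refine Measurable.iSup fun N => ?_
  have hsN : MeasurableSet (s ∩ Set.Ioo (-(N : ℝ)) N) := hs.inter measurableSet_Ioo
  -- Truncation makes the subtrahend finite, so the singular part is a genuine difference.
  have e : ∀ r, (μ r).singularPart volume (s ∩ Set.Ioo (-(N : ℝ)) N)
      = μ r (s ∩ Set.Ioo (-(N : ℝ)) N)
        - volume.withDensity (boundaryDensity h r) (s ∩ Set.Ioo (-(N : ℝ)) N) := by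
    intro r
    have := (hμ r).isLocallyFiniteMeasure
    have h1 := congrArg (fun m => m (s ∩ Set.Ioo (-(N : ℝ)) N))
      (singularPart_add_withDensity_boundaryDensity (hμ r))
    simp only [Measure.add_apply] at h1
    refine ENNReal.eq_sub_of_add_eq ?_ h1
    refine ne_top_of_le_ne_top ?_ (h1 ▸ le_add_self)
    exact measure_ne_top_of_subset Set.inter_subset_right measure_Ioo_lt_top.ne
  simp_rw [e]
  exact ((Measure.measurable_coe hsN).comp hm).sub ((Measure.measurable_coe hsN).comp hd)

-- Rational a cost only countably many null sets; outside them the deterministic alternative applies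
-- to the sequence h(x + i / (n + 1)).
open Filter Topology in
theorem IsHerglotz.ae_lintegral_boundaryDensity (hh : IsHerglotz h)
    (hμ : ∀ r, IsHerglotzMeasure (herglotzShift h r) (μ r)) :
    ∀ᵐ x : ℝ, let ρ := ((volume.restrict (Set.Icc 0 1)).bind μ).rnDeriv volume x
      let A := ∫⁻ r in Set.Icc (0 : ℝ) 1, boundaryDensity h r x
      ρ < ∞ ∧ (A = ρ ∨ (A = 0 ∧ (ρ = 0 ∨ ρ = 1))) := by
  have h1 : ∀ᵐ x : ℝ, ∀ a : ℚ, _ := ae_all_iff.2 fun a : ℚ =>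
    hh.ae_tendsto_poissonIntegral_bind hμ (Set.Iic (a : ℝ))
  have h2 : ∀ᵐ x : ℝ, ∀ a : ℚ, _ := ae_all_iff.2 fun a : ℚ =>
    IsHerglotz.ae_tendsto_halfPlaneKernel (a : ℝ) (hμ a)
  filter_upwards [h1, h2, hh.ae_tendsto_poissonIntegral_bind hμ (Set.Icc 0 1)] with x hx1 hx2 hx3
  refine ⟨hx3.1, ?_⟩
  refine lintegral_liminf_halfPlaneKernel (fun n => hh.verticalSeq_im_pos n x) (fun a => ?_)
    (fun a => ?_) hx3.2 rfl
  · obtain ⟨hlt, hlim⟩ := hx1 a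
    have h3 := (ENNReal.tendsto_toReal hlt.ne).comp hlim
    simp_rw [Function.comp_def, fun n => poissonIntegral_restrict_Iic (hh.verticalSeq_im_pos n x)
      (verticalSeq h n x).re (a : ℝ)] at h3
    refine ⟨_, ((h3.sub_const (1 / 2)).mul_const Real.pi).congr fun n => ?_⟩
    rw [ENNReal.toReal_ofReal, add_sub_cancel_left, div_mul_cancel₀ _ Real.pi_ne_zero]
    have h4 := (Real.neg_pi_div_two_lt_arctan
      ((a - (verticalSeq h n x).re) / (verticalSeq h n x).im)).le
    have h5 : -(1 / 2) ≤ Real.arctan ((a - (verticalSeq h n x).re) / (verticalSeq h n x).im)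
        / Real.pi := by
      rw [le_div_iff₀ Real.pi_pos]
      linarith
    linarith
  · obtain ⟨hlt, hlim⟩ := hx2 a
    refine ⟨_, ((ENNReal.tendsto_toReal hlt.ne).comp hlim).congr fun n => ?_⟩
    exact ENNReal.toReal_ofReal (halfPlaneKernel_nonneg (hh.verticalSeq_im_pos n x).le _ _)

/-- The Lebesgue decomposition of each μ_r, integrated over r with Tonelli's theorem. -/
theorem IsHerglotz.averagedSingularMeasure_add (hh : IsHerglotz h)
    (hμ : ∀ r, IsHerglotzMeasure (herglotzShift h r) (μ r)) :
    averagedSingularMeasure μ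
        + volume.withDensity (fun x => ∫⁻ r in Set.Icc (0 : ℝ) 1, boundaryDensity h r x)
      = (volume.restrict (Set.Icc 0 1)).bind μ := by
  have hm := hh.measurable_herglotzMeasure hμ
  have hs := hh.measurable_singularPart hμ
  have hd := hh.measurable_boundaryDensity
  ext s hs'
  rw [Measure.add_apply, averagedSingularMeasure, Measure.bind_apply hs' hs.aemeasurable,
    Measure.bind_apply hs' hm.aemeasurable, withDensity_apply _ hs',
    lintegral_lintegral_swap (f := fun x r => boundaryDensity h r x)
      (hd.comp measurable_swap).aemeasurable,
    ← lintegral_add_left (f := fun r => (μ r).singularPart volume s)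
      ((Measure.measurable_coe hs').comp hs)]
  refine lintegral_congr fun r => ?_
  conv_rhs => rw [← singularPart_add_withDensity_boundaryDensity (hμ r), Measure.add_apply,
    withDensity_apply _ hs']

end Average

/-! ### Conclusion -/

theorem theorem1 (h : ℂ → ℂ) (hh : IsHerglotz h) :
    -- the measures `μ_r` exist and are unique
    (∀ r : ℝ, ∃! ν : Measure ℝ, IsHerglotzMeasure (herglotzShift h r) ν) ∧
    ∀ μ : ℝ → Measure ℝ, (∀ r : ℝ, IsHerglotzMeasure (herglotzShift h r) (μ r)) →
      -- the integral over `r` is meaningful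
      AEMeasurable (fun r => (μ r).singularPart volume)
        (volume.restrict (Set.Icc (0 : ℝ) 1)) ∧
      averagedSingularMeasure μ ≪ volume ∧
      ∃ f : ℝ → ℝ≥0∞, Measurable f ∧
        averagedSingularMeasure μ = volume.withDensity f ∧
        ∀ᵐ x : ℝ, f x = 0 ∨ f x = 1 := by
  refine ⟨fun r => ?_, fun μ hμ => ?_⟩
  · obtain ⟨α, β, ν, hν⟩ := (isHerglotz_herglotzShift hh r).exists_isHerglotzTriple
    exact ⟨ν, ⟨α, β, hν⟩, fun ν' hν' => hν'.unique ⟨α, β, hν⟩⟩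
  · let η := (volume.restrict (Set.Icc (0 : ℝ) 1)).bind μ
    let A : ℝ → ℝ≥0∞ := fun x => ∫⁻ r in Set.Icc (0 : ℝ) 1, boundaryDensity h r x
    have hA : Measurable A :=
      (hh.measurable_boundaryDensity.comp measurable_swap).lintegral_prod_right'
    have hρ : Measurable (η.rnDeriv volume) := Measure.measurable_rnDeriv _ _
    have hae := hh.ae_lintegral_boundaryDensity hμ
    have hac : η ≪ volume :=
      Measure.absolutelyContinuous_of_le_smul (hh.bind_le_smul_volume hμ (Set.Icc 0 1))
    have hlf : IsLocallyFiniteMeasure η :=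
      Measure.isLocallyFiniteMeasure_of_le (hh.bind_le_smul_volume hμ (Set.Icc 0 1))
    -- σ-finiteness allows this measure to be cancelled from both sides in `hf`.
    have hAfin : SigmaFinite (volume.withDensity A) := by
      refine SigmaFinite.withDensity_of_ne_top ?_
      filter_upwards [hae] with x hx
      rcases hx.2 with h1 | h1
      · exact h1.trans_ne hx.1.ne
      · exact h1.1.trans_ne ENNReal.zero_ne_top
    have hf : averagedSingularMeasure μ
        = volume.withDensity (fun x => η.rnDeriv volume x - A x) := by
      rw [← Measure.add_left_inj (volume.withDensity A), hh.averagedSingularMeasure_add hμ,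
        ← withDensity_add_right _ hA]
      change η = _
      conv_lhs => rw [← Measure.withDensity_rnDeriv_eq η volume hac]
      refine withDensity_congr_ae ?_
      filter_upwards [hae] with x hx
      refine (tsub_add_cancel_of_le ?_).symm
      rcases hx.2 with h1 | h1
      · exact h1.le
      · exact h1.1.trans_le zero_le
    refine ⟨(hh.measurable_singularPart hμ).aemeasurable, ?_, _, hρ.sub hA, hf, ?_⟩
    · rw [hf]
      exact withDensity_absolutelyContinuous _ _
    · filter_upwards [hae] with x hx
      rcases hx.2 with h1 | ⟨h1, h2⟩
      · left
        exact tsub_eq_zero_of_le h1.ge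
      · have h1 : A x = 0 := h1
        simpa [h1] using h2
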